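/- Let $d\ge 1$, let $\chi$ be a finite set of spins, $H:\chi^2\to\mathbb{R}\cup\{\infty\}$ symmetric and $h:\chi\to\mathbb{R}$. For a finite $\Lambda\subset\mathbb{Z}^d$ with its induced nearest-neighbour graph let $Z_\Lambda=\sum_{\sigma\in\chi^\Lambda}\exp\big(-\sum_{\{u,v\}\in E(\Lambda)}H(\sigma_u,\sigma_v)-\sum_{v\in\Lambda}h(\sigma_v)\big)$, and let $\mathbb{P}_\Lambda$ be the corresponding finite-volume Gibbs measure. For $A\subset\mathbb{Z}^d$ let $\partial A$ be the set of sites of $A$ with a neighbour outside $A$, and let $B_r(X)$ be the set of sites at graph distance at most $r$ from $X$. Strong spatial mixing (SSM): for every finite $X\subset\mathbb{Z}^d$ and every $Y\subset\mathbb{Z}^d$ there is $R:\mathbb{N}\to\mathbb{R}$ with $R(r)\to0$ such that for all $r\ge1$ the conditional probability of $\{\sigma_v=s^1_v,\ v\in X\}$, given $\sigma=s^2$ on $Y$ and $\sigma=s^3$ on $\partial B_r(X)$, changes by at most $R(r)$ when $s^3$ is replaced by $s^4$, for all assignments $s^1,s^2,s^3,s^4$ for which both conditional probabilities are defined. (By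 the spatial Markov property they are conditional probabilities of $\mathbb{P}_{B_r(X)}$.) SSM is exponential if one can take $R(r)=\kappa e^{-\gamma r}$ with $\kappa,\gamma>0$. Let $\prec$ be the lexicographic order on $\mathbb{Z}^d$ in which the last coordinate is the most significant one. For $D\subset\mathbb{Z}^d$ with $0\in D$ and $s\in\chi$ write $\mathbb{P}_D(\sigma_0=s\mid\mathcal{E}_s)$ for the probability of $\sigma_0=s$ under the Gibbs measure of the model on the graph induced by $D$ in which all spins at sites $u\in D$, $u\succ 0$, are fixed to $s$; it is well defined if this Gibbs measure is unique. Write $\mathbb{P}=\mathbb{P}_{\mathbb{Z}^d}$, and for $1\le j\le d$, $k\ge0$ let $\mathbb{Z}^d_{j,k,+}=\{v:v_j\le k\}$, $\mathbb{Z}^d_{j,k,-}=\{v:v_j\ge-k\}$. Theorem. Suppose that the model on $\mathbb{Z}^d$ satisfies SSM and that $s^*\in\chi$ is such that $H(s,s^*)<\infty$ for all $s\in\chi$. Then $\mathbb{P}(\sigma_0=s^*\mid\mathcal{E}_{s^*})$ is well defined and positive, and the free energy $$\mathcal{P}=\lim_{n\to\infty}\frac{\log Z_{\Lambda_n}}{|\Lambda_n|}$$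 exists along every sequence of non-empty finite sets $\Lambda_n\subset\mathbb{Z}^d$ with $|\partial\Lambda_n|/|\Lambda_n|\to0$ and equals $$\mathcal{P}=-\log\mathbb{P}(\sigma_0=s^*\mid\mathcal{E}_{s^*})-dH(s^*,s^*)-h(s^*).$$ Suppose in addition that SSM is exponential and that the probabilities $\mathbb{P}_{\mathbb{Z}^d_{j,k,\pm}}(\sigma_0=s^*\mid\mathcal{E}_{s^*})$ are well defined (that is, the corresponding Gibbs measures are unique) for all $1\le j\le d$ and $k\ge0$. Then these probabilities are positive. For $a\in\mathbb{R}_{>0}^d$ let $B_{an}=\{u\in\mathbb{Z}^d:|u_j|\le a_jn,\ 1\le j\le d\}$, $A_j(a)=\prod_{i\ne j}(2a_i)$ and $A(a)=\sum_jA_j(a)$. Then for every $a\in\mathbb{R}_{>0}^d$ the surface pressure $$s\mathcal{P}(a)=\lim_{n\to\infty}\frac{\log Z_{B_{an}}-|B_{an}|\,\mathcal{P}}{A(a)\,n^{d-1}}$$ exists and equals $$s\mathcal{P}(a)=H(s^*,s^*)+\sum_{j=1}^d\frac{A_j(a)}{A(a)}\sum_{k=0}^\infty\Big(2\log\mathbb{P}(\sigma_0=s^*\mid\mathcal{E}_{s^*})-\log\mathbb{P}_{\mathbb{Z}^d_{j,k,+}}(\sigma_0=s^*\mid\mathcal{E}_{s^*})-\log\mathbb{P}_{\mathbb{Z}^d_{j,k,-}}(\sigma_0=s^*\mid\mathcal{E}_{s^*})\Big),$$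 where the infinite sums converge. -/

import Mathlib

noncomputable section

namespace SpinModel

open Filter Topology MeasureTheory

/-- The vertices of the lattice `ℤ^d`. -/
abbrev Site (d : ℕ) : Type := Fin d → ℤ

/-- The `ℓ¹` distance on `ℤ^d`; it is also the graph distance of the lattice. -/
def l1 {d : ℕ} (u v : Site d) : ℕ := ∑ i, (u i - v i).natAbs

/-- Nearest neighbours in `ℤ^d`. -/
def Adj {d : ℕ} (u v : Site d) : Prop := l1 u v = 1

/-- The lexicographic order `v ≺ u` on `ℤ^d`, in which the last coordinate is the most
significant one. -/
def LexLT {d : ℕ} (v u : Site d) : Prop := ∃ k, v k < u k ∧ ∀ j, k < j → v j = u j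

/-- `B_r(X)`, the set of sites at distance at most `r` from the finite set `X`. -/
def ball {d : ℕ} (X : Finset (Site d)) (r : ℕ) : Finset (Site d) :=
  X.biUnion fun v =>
    (Finset.Icc (fun i => v i - (r : ℤ)) (fun i => v i + (r : ℤ))).filter fun u => l1 u v ≤ r

theorem mem_ball {d : ℕ} {X : Finset (Site d)} {r : ℕ} {u : Site d} :
    u ∈ ball X r ↔ ∃ v ∈ X, l1 u v ≤ r := by
  simp only [ball, Finset.mem_biUnion, Finset.mem_filter, Finset.mem_Icc]
  refine exists_congr fun v => and_congr_right fun _ => ⟨fun h => h.2, fun h => ⟨?_, h⟩⟩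
  have key : ∀ i, (u i - v i).natAbs ≤ r := fun i =>
    (Finset.single_le_sum (f := fun i => (u i - v i).natAbs) (fun _ _ => Nat.zero_le _)
      (Finset.mem_univ i)).trans h
  constructor <;> intro i <;> have := key i <;> simp only <;> omega

/-- The (inner) boundary of `A` in the subgraph of `ℤ^d` induced by `D`:
the sites of `A` with a neighbour in `D` outside `A`. -/
def bdry {d : ℕ} (D A : Set (Site d)) : Set (Site d) :=
  {v | v ∈ A ∧ ∃ u ∈ D, Adj v u ∧ u ∉ A}

/-- The box `B_{an} = {u : |u_j| ≤ a_j n}`. -/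
def box {d : ℕ} (a : Fin d → ℝ) (n : ℕ) : Finset (Site d) :=
  Finset.Icc (fun j => -⌊a j * n⌋) (fun j => ⌊a j * n⌋)

theorem mem_box {d : ℕ} {a : Fin d → ℝ} {n : ℕ} {u : Site d} :
    u ∈ box a n ↔ ∀ j, |(u j : ℝ)| ≤ a j * n := by
  simp only [box, Finset.mem_Icc, Pi.le_def, ← forall_and]
  refine forall_congr' fun j => ?_
  rw [abs_le, Int.le_floor, neg_le, Int.le_floor, neg_le (a := a j * (n : ℝ))]
  push_cast
  rfl

/-- The half-space `ℤ^d_{j,k,+}`. -/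
def halfPlus {d : ℕ} (j : Fin d) (k : ℕ) : Set (Site d) := {v | v j ≤ (k : ℤ)}

/-- The half-space `ℤ^d_{j,k,-}`. -/
def halfMinus {d : ℕ} (j : Fin d) (k : ℕ) : Set (Site d) := {v | -(k : ℤ) ≤ v j}

/-- `A_j(a) = ∏_{i ≠ j} 2 a_i`. -/
def faceArea {d : ℕ} (a : Fin d → ℝ) (j : Fin d) : ℝ := ∏ i ∈ Finset.univ.erase j, 2 * a i

/-- `A(a) = ∑_j A_j(a)`. -/
def area {d : ℕ} (a : Fin d → ℝ) : ℝ := ∑ j, faceArea a j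

section Model

variable {d : ℕ} {χ : Type*} (H : χ → χ → WithTop ℝ) (h : χ → ℝ)

/-- The Boltzmann factor `exp (-x)`, with `exp (-∞) = 0`. -/
def boltzmann : WithTop ℝ → ℝ
  | ⊤ => 0
  | (x : ℝ) => Real.exp (-x)

open scoped Classical in
/-- The energy of a configuration on the graph induced by the finite set `Λ`. Each undirected edge
is listed once, through its endpoints in increasing lexicographic order. -/
def energy (Λ : Finset (Site d)) (σ : Λ → χ) : WithTop ℝ :=
  (∑ p ∈ (Finset.univ : Finset (Λ × Λ)).filter
      (fun p => Adj (p.1 : Site d) p.2 ∧ LexLT (p.1 : Site d) p.2), H (σ p.1) (σ p.2))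
    + ∑ v, ((h (σ v) : ℝ) : WithTop ℝ)

/-- The unnormalized Gibbs weight of a configuration on `Λ`. -/
def weight (Λ : Finset (Site d)) (σ : Λ → χ) : ℝ := boltzmann (energy H h Λ σ)

/-- The configurations on the set `D` of sites that agree with `τ` at the sites of `S`. -/
def agree (D : Set (Site d)) (S : Set (Site d)) (τ : Site d → χ) : Set (D → χ) :=
  {σ | ∀ v : D, (v : Site d) ∈ S → σ v = τ v}

variable [Fintype χ]

/-- The partition function `Z_Λ`. -/
def partitionFn (Λ : Finset (Site d)) : ℝ := ∑ σ : Λ → χ, weight H h Λ σ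

/-- The total weight of an event on `Λ`, i.e. `Z_Λ · ℙ_Λ(E)`. -/
def mass (Λ : Finset (Site d)) (E : Set (Λ → χ)) : ℝ :=
  ∑ σ : Λ → χ, E.indicator (weight H h Λ) σ

/-- The conditional probability `ℙ_Λ(E | F)` under the finite-volume Gibbs measure on the graph
induced by `Λ`; it is meaningful if `mass H h Λ F ≠ 0`. -/
def condProb (Λ : Finset (Site d)) (E F : Set (Λ → χ)) : ℝ :=
  mass H h Λ (E ∩ F) / mass H h Λ F

/-- The conditioning event of strong spatial mixing: spins `s₂` on `Y` and `s₃` on the boundary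
of `B_r(X)`. -/
def ssmEvent (X : Finset (Site d)) (Y : Set (Site d)) (r : ℕ) (s₂ s₃ : Site d → χ) :
    Set (ball X r → χ) :=
  agree (ball X r) Y s₂ ∩ agree (ball X r) (bdry Set.univ (ball X r)) s₃

/-- `R` bounds the influence on `X`, given the spins on `Y`, of the spins on the boundary of
`B_r(X)`. By the spatial Markov property, the law of the spins of `X` given those on `Y` and on the
boundary of `B_r(X)` is that of the finite-volume model on `B_r(X)`. The assignments range over
those for which the conditional probabilities are defined. -/
def IsSSMRate (X : Finset (Site d)) (Y : Set (Site d)) (R : ℕ → ℝ) : Prop :=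
  ∀ r : ℕ, 1 ≤ r → ∀ s₁ s₂ s₃ s₄ : Site d → χ,
    mass H h (ball X r) (ssmEvent X Y r s₂ s₃) ≠ 0 →
    mass H h (ball X r) (ssmEvent X Y r s₂ s₄) ≠ 0 →
    |condProb H h (ball X r) (agree (ball X r) X s₁) (ssmEvent X Y r s₂ s₃)
      - condProb H h (ball X r) (agree (ball X r) X s₁) (ssmEvent X Y r s₂ s₄)| ≤ R r

variable (d) in
/-- Strong spatial mixing of the model on `ℤ^d`. -/
def SSM : Prop :=
  ∀ (X : Finset (Site d)) (Y : Set (Site d)),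
    ∃ R : ℕ → ℝ, Tendsto R atTop (𝓝 0) ∧ IsSSMRate H h X Y R

variable (d) in
/-- Exponential strong spatial mixing of the model on `ℤ^d`. -/
def ExpSSM : Prop :=
  ∀ (X : Finset (Site d)) (Y : Set (Site d)),
    ∃ κ γ : ℝ, 0 < κ ∧ 0 < γ ∧ IsSSMRate H h X Y fun r => κ * Real.exp (-γ * r)

/-- `μ` is a Gibbs measure, on the subgraph of `ℤ^d` induced by `D`, of the model in which the
spins at the sites of `Y` are fixed to the values `η`. The field `markov` is the spatial Markov
property: given the spins on the boundary of a finite set `A`, the spins in `A` follow the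
finite-volume Gibbs measure on `A`. (Where the finite-volume conditional probability is not defined,
it is `0`, so that forbidden configurations get probability `0`.) -/
structure IsGibbs [MeasurableSpace χ] (D Y : Set (Site d)) (η : Site d → χ)
    (μ : Measure (D → χ)) : Prop where
  prob : IsProbabilityMeasure μ
  fixed : ∀ᵐ σ ∂μ, σ ∈ agree D Y η
  markov : ∀ A : Finset (Site d), (A : Set (Site d)) ⊆ D → ∀ ω : Site d → χ,
    μ.real (agree D A ω) =
      condProb H h A (agree A A ω) (agree A (bdry D A ∪ (Y ∩ A)) ω)
        * μ.real (agree D (bdry D A ∪ (Y ∩ A)) ω)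

/-- `ℙ_D(σ_0 = s | σ_u = s for all u ≻ 0)` is well defined and equal to `p`: the model on `D` in
which all sites `u ≻ 0` have the spin `s` has exactly one Gibbs measure, and it gives the event
`σ_0 = s` the probability `p`. -/
def IsCavityMarginal [MeasurableSpace χ] (D : Set (Site d)) (s : χ) (p : ℝ) : Prop :=
  ∃ μ : Measure (D → χ),
    (∀ ν : Measure (D → χ), IsGibbs H h D {u | LexLT 0 u} (fun _ => s) ν ↔ ν = μ) ∧
    μ.real (agree D {0} fun _ => s) = p

variable (d) in
/-- `P` is the free energy (pressure) of the model: the limit of `log Z_{Λ_n} / |Λ_n|` along every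
sequence of finite sets whose boundary is negligible with respect to their volume. -/
def IsFreeEnergy (P : ℝ) : Prop :=
  ∀ Λ : ℕ → Finset (Site d), (∀ n, (Λ n).Nonempty) →
    Tendsto (fun n => ((bdry Set.univ (Λ n : Set (Site d))).ncard : ℝ) / (Λ n).card) atTop (𝓝 0) →
    Tendsto (fun n => Real.log (partitionFn H h (Λ n)) / (Λ n).card) atTop (𝓝 P)

/-- `L` is the surface pressure for the boxes `B_{an}`, where `P` is the free energy. -/
def IsSurfacePressure (P : ℝ) (a : Fin d → ℝ) (L : ℝ) : Prop :=
  Tendsto (fun n : ℕ =>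
      (Real.log (partitionFn H h (box a n)) - (box a n).card * P) / (area a * (n : ℝ) ^ (d - 1)))
    atTop (𝓝 L)

end Model

end SpinModel

end

noncomputable section

namespace SpinModel

open Filter Topology MeasureTheory

/-! Fix the spins of `Λ` to `s` one site at a time, in decreasing lexicographic order. The total
weight drops from `Z_Λ` to the weight of the constant configuration, each time by a factor that is a
conditional probability. So `Z_Λ` is the constant weight divided by `∏ q_v`, where `q_v` is the
probability of `s` at `v` given `s` at all later sites of `Λ` (`log_partitionFn`). After a
translation, `q_v` is a cavity probability at the origin of `Λ - v`. The constant weight is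
explicit: each site costs `d H(s,s) + h(s)`, up to the edges missing at the boundary.

Since `s` is compatible with every spin, `q_v` is bounded below uniformly in `v` and `Λ`
(`exists_pos_le_cavity`), so estimates of probabilities carry over to logarithms. By compactness,
limits of Gibbs measures along locally convergent graphs are Gibbs measures
(`exists_isGibbs_limit`). Hence, if the Gibbs measure on `D` is unique, `q_v` is close to its value
on `D` as soon as `Λ - v` looks like `D` near the origin (`exists_abs_real_sub_lt`). Strong spatial
mixing gives uniqueness on `ℤ^d` (`IsGibbs.eq_of_ssm`), so `q_v` is close to `p` except within a
bounded distance of the boundary; this is the free energy.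

For boxes, `log p - log q_v` has to be summed to order `n^(d-1)`. Exponential mixing makes it
exponentially small in the distance to the boundary. Near a single face, at depth `k`, the box looks
like a half-space, which gives the terms of the series; the corners have codimension two and do not
count (`exists_abs_sub_sum_faces_le`, `tendsto_sum_symBox_div`). The edges missing at the faces
yield the summand `H(s,s)`. -/

theorem boltzmann_nonneg (x : WithTop ℝ) : 0 ≤ boltzmann x := by
  cases x with
  | top => exact le_rfl
  | coe x => exact (Real.exp_pos _).le

theorem boltzmann_coe (x : ℝ) : boltzmann x = Real.exp (-x) := rfl

theorem boltzmann_zero : boltzmann 0 = 1 := by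
  have := boltzmann_coe 0
  simpa using this

theorem boltzmann_add (x y : WithTop ℝ) : boltzmann (x + y) = boltzmann x * boltzmann y := by
  cases x with
  | top => rw [top_add]; exact (zero_mul _).symm
  | coe x =>
    cases y with
    | top => rw [add_top]; exact (mul_zero _).symm
    | coe y =>
      rw [← WithTop.coe_add, boltzmann_coe, boltzmann_coe, boltzmann_coe, neg_add, Real.exp_add]

theorem boltzmann_sum {ι : Type*} (t : Finset ι) (f : ι → WithTop ℝ) :
    boltzmann (∑ i ∈ t, f i) = ∏ i ∈ t, boltzmann (f i) := by
  classical
  induction t using Finset.induction_on with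
  | empty => simpa using boltzmann_zero
  | insert a t ha ih => rw [Finset.sum_insert ha, Finset.prod_insert ha, boltzmann_add, ih]

theorem boltzmann_pos {x : WithTop ℝ} (hx : x ≠ ⊤) : 0 < boltzmann x := by
  cases x with
  | top => exact absurd rfl hx
  | coe x => exact Real.exp_pos _

/-! ### Gibbs weights and the spatial Markov property in finite volume -/

section

variable {d : ℕ} {χ : Type*} (H : χ → χ → WithTop ℝ) (h : χ → ℝ)

open scoped Classical in
/-- The contribution of the ordered pair `p` of sites to the weight of `σ`. -/
def pairFactor (σ : Site d → χ) (p : Site d × Site d) : ℝ :=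
  if Adj p.1 p.2 ∧ LexLT p.1 p.2 then boltzmann (H (σ p.1) (σ p.2)) else 1

/-- The Gibbs weight on `Λ` of a configuration defined on the whole lattice. -/
def globalWeight (Λ : Finset (Site d)) (σ : Site d → χ) : ℝ :=
  (∏ p ∈ Λ ×ˢ Λ, pairFactor H σ p) * ∏ v ∈ Λ, Real.exp (-h (σ v))

theorem pairFactor_nonneg (σ : Site d → χ) (p : Site d × Site d) : 0 ≤ pairFactor H σ p := by
  unfold pairFactor
  split_ifs
  exacts [boltzmann_nonneg _, zero_le_one]

theorem globalWeight_nonneg (Λ : Finset (Site d)) (σ : Site d → χ) : 0 ≤ globalWeight H h Λ σ :=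
  mul_nonneg (Finset.prod_nonneg fun _ _ => pairFactor_nonneg H σ _)
    (Finset.prod_nonneg fun _ _ => (Real.exp_pos _).le)

theorem weight_restrict (Λ : Finset (Site d)) (σ : Site d → χ) :
    weight H h Λ (fun v => σ v) = globalWeight H h Λ σ := by
  classical
  unfold weight energy globalWeight
  rw [boltzmann_add, boltzmann_sum, boltzmann_sum]
  congr 1
  · rw [Finset.prod_filter, ← Finset.univ_product_univ, Finset.prod_product, Finset.prod_product,
      ← Finset.prod_coe_sort Λ]
    refine Finset.prod_congr rfl fun u _ => ?_
    rw [← Finset.prod_coe_sort Λ]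
    refine Finset.prod_congr rfl fun v _ => ?_
    simp only [pairFactor]
  · rw [← Finset.prod_coe_sort Λ]
    exact Finset.prod_congr rfl fun v _ => boltzmann_coe _

theorem mem_agree {D S : Set (Site d)} {τ : Site d → χ} {σ : D → χ} :
    σ ∈ agree D S τ ↔ ∀ v : D, (v : Site d) ∈ S → σ v = τ v := Iff.rfl

open scoped Classical in
/-- The configuration on the lattice that equals `σ` on `D` and `η` elsewhere. -/
def extend (D : Set (Site d)) (η : Site d → χ) (σ : D → χ) : Site d → χ :=
  fun v => if hv : v ∈ D then σ ⟨v, hv⟩ else η v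

theorem extend_of_mem {D : Set (Site d)} {η : Site d → χ} {σ : D → χ} {v : Site d} (hv : v ∈ D) :
    extend D η σ v = σ ⟨v, hv⟩ := dif_pos hv

theorem extend_of_notMem {D : Set (Site d)} {η : Site d → χ} {σ : D → χ} {v : Site d}
    (hv : v ∉ D) : extend D η σ v = η v := dif_neg hv

theorem weight_eq_globalWeight_extend (Λ : Finset (Site d)) (η : Site d → χ) (σ : Λ → χ) :
    weight H h Λ σ = globalWeight H h Λ (extend (Λ : Set (Site d)) η σ) := by
  rw [← weight_restrict]
  congr 1
  funext v
  exact (extend_of_mem (D := (Λ : Set (Site d))) v.2).symm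

theorem weight_nonneg (Λ : Finset (Site d)) (σ : Λ → χ) : 0 ≤ weight H h Λ σ :=
  boltzmann_nonneg _

/-- The part of the weight on `Λ` that does not come from the graph induced by `A`. -/
def outerWeight (A Λ : Finset (Site d)) (σ : Site d → χ) : ℝ :=
  (∏ p ∈ (Λ ×ˢ Λ) \ (A ×ˢ A), pairFactor H σ p) * ∏ v ∈ Λ \ A, Real.exp (-h (σ v))

theorem globalWeight_eq_mul {A Λ : Finset (Site d)} (hA : A ⊆ Λ) (σ : Site d → χ) :
    globalWeight H h Λ σ = globalWeight H h A σ * outerWeight H h A Λ σ := by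
  unfold globalWeight outerWeight
  rw [← Finset.prod_sdiff (Finset.product_subset_product hA hA), ← Finset.prod_sdiff hA]
  ring

theorem adj_comm {u v : Site d} : Adj u v ↔ Adj v u := by
  unfold Adj l1
  simp only [← Int.natAbs_neg (u _ - v _), neg_sub]

theorem globalWeight_congr {Λ : Finset (Site d)} {σ τ : Site d → χ} (hστ : ∀ v ∈ Λ, σ v = τ v) :
    globalWeight H h Λ σ = globalWeight H h Λ τ := by
  unfold globalWeight
  congr 1
  · refine Finset.prod_congr rfl fun p hp => ?_
    rw [Finset.mem_product] at hp
    simp only [pairFactor, hστ _ hp.1, hστ _ hp.2]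
  · exact Finset.prod_congr rfl fun v hv => by rw [hστ v hv]

/-- An edge that is not inside `A` has an endpoint outside `A`, so an endpoint that it has in `A` is
a boundary site. This locality is the source of the Markov property. -/
theorem outerWeight_congr {A Λ : Finset (Site d)} {σ τ : Site d → χ}
    (hout : ∀ v ∈ Λ, v ∉ A → σ v = τ v) (hbd : ∀ v ∈ bdry (Λ : Set (Site d)) A, σ v = τ v) :
    outerWeight H h A Λ σ = outerWeight H h A Λ τ := by
  unfold outerWeight
  congr 1
  · refine Finset.prod_congr rfl fun p hp => ?_
    simp only [Finset.mem_sdiff, Finset.mem_product, not_and_or] at hp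
    obtain ⟨⟨h1, h2⟩, h3⟩ := hp
    unfold pairFactor
    split_ifs with hadj
    · have e1 : σ p.1 = τ p.1 := by
        by_cases hm : p.1 ∈ A
        · exact hbd _ ⟨hm, p.2, h2, hadj.1, by simpa using h3.resolve_left (not_not.2 hm)⟩
        · exact hout _ h1 hm
      have e2 : σ p.2 = τ p.2 := by
        by_cases hm : p.2 ∈ A
        · exact hbd _ ⟨hm, p.1, h1, adj_comm.1 hadj.1,
            by simpa using h3.resolve_right (not_not.2 hm)⟩
        · exact hout _ h2 hm
      rw [e1, e2]
    · rfl
  · refine Finset.prod_congr rfl fun v hv => ?_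
    rw [Finset.mem_sdiff] at hv
    rw [hout v hv.1 hv.2]

variable [Fintype χ]

theorem mass_nonneg (Λ : Finset (Site d)) (E : Set (Λ → χ)) : 0 ≤ mass H h Λ E :=
  Finset.sum_nonneg fun _ _ => Set.indicator_nonneg (fun _ _ => weight_nonneg H h Λ _) _

theorem mass_mono {Λ : Finset (Site d)} {E F : Set (Λ → χ)} (hEF : E ⊆ F) :
    mass H h Λ E ≤ mass H h Λ F :=
  Finset.sum_le_sum fun _ _ =>
    Set.indicator_le_indicator_of_subset hEF (fun _ => weight_nonneg H h Λ _) _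

theorem weight_le_mass {Λ : Finset (Site d)} {E : Set (Λ → χ)} {σ : Λ → χ} (hσ : σ ∈ E) :
    weight H h Λ σ ≤ mass H h Λ E := by
  have := Finset.single_le_sum (f := fun σ => E.indicator (weight H h Λ) σ)
    (fun σ _ => Set.indicator_nonneg (fun _ _ => weight_nonneg H h Λ _) σ) (Finset.mem_univ σ)
  simp only [Set.indicator_of_mem hσ] at this
  exact this

theorem exists_weight_pos_of_mass_ne_zero {Λ : Finset (Site d)} {E : Set (Λ → χ)}
    (hE : mass H h Λ E ≠ 0) : ∃ σ ∈ E, 0 < weight H h Λ σ := by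
  obtain ⟨σ, -, hσ⟩ := Finset.exists_ne_zero_of_sum_ne_zero hE
  have hm := Set.mem_of_indicator_ne_zero hσ
  rw [Set.indicator_of_mem hm] at hσ
  exact ⟨σ, hm, lt_of_le_of_ne (weight_nonneg H h Λ σ) hσ.symm⟩

theorem condProb_nonneg (Λ : Finset (Site d)) (E F : Set (Λ → χ)) : 0 ≤ condProb H h Λ E F :=
  div_nonneg (mass_nonneg H h Λ _) (mass_nonneg H h Λ _)

open scoped Classical in
theorem mass_agree (Λ : Finset (Site d)) (S : Set (Site d)) (τ : Site d → χ) :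
    mass H h Λ (agree Λ S τ) =
      ∑ σ : Λ → χ with ∀ v : Λ, (v : Site d) ∈ S → σ v = τ v, weight H h Λ σ := by
  unfold mass
  rw [Finset.sum_filter]
  refine Finset.sum_congr rfl fun σ _ => ?_
  rw [Set.indicator_apply]
  exact if_congr mem_agree rfl rfl

theorem mass_agree_self (A : Finset (Site d)) (ω : Site d → χ) :
    mass H h A (agree A A ω) = globalWeight H h A ω := by
  classical
  rw [mass_agree, ← weight_restrict]
  refine (Finset.sum_congr ?_ fun _ _ => rfl).trans (Finset.sum_singleton _ _)
  ext σ
  simp only [Finset.mem_filter, Finset.mem_univ, true_and, Finset.mem_singleton]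
  exact ⟨fun hσ => funext fun v => hσ v v.2, fun hσ v _ => by rw [hσ]⟩

/-- The spatial Markov property, for masses. -/
theorem mass_mul_mass_of_bdry_subset {A Λ : Finset (Site d)} (hA : A ⊆ Λ) {S Y : Set (Site d)}
    (hbS : bdry (Λ : Set (Site d)) A ⊆ S) (hSA : S ⊆ A) (hYS : Y ∩ A ⊆ S) (ω : Site d → χ) :
    mass H h Λ (agree Λ (A ∪ Y) ω) * mass H h A (agree A S ω) =
      globalWeight H h A ω * mass H h Λ (agree Λ (S ∪ Y) ω) := by
  classical
  rw [mass_agree, mass_agree, mass_agree, Finset.sum_mul_sum, ← Finset.sum_product',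
    Finset.mul_sum]
  -- Swap the two configurations inside `A`. In `σ` the spins in `A` are those of `ω`, so replacing
  -- them by `τ` loses nothing. The outer weight is unchanged because `σ` and `τ` agree on the
  -- boundary of `A`.
  refine Finset.sum_nbij'
    (fun q v => if hv : (v : Site d) ∈ A then q.2 ⟨v, hv⟩ else q.1 v)
    (fun σ => (fun v => if (v : Site d) ∈ A then ω v else σ v, fun v => σ ⟨v, hA v.2⟩))
    ?_ ?_ ?_ ?_ ?_
  · rintro ⟨σ, τ⟩ hq
    simp only [Finset.mem_product, Finset.mem_filter, Finset.mem_univ, true_and] at hq ⊢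
    intro v hv
    split_ifs with hvA
    · exact hq.2 ⟨v, hvA⟩ (hv.elim id fun hY => hYS ⟨hY, hvA⟩)
    · exact hq.1 v (Or.inr (hv.resolve_left fun hS => hvA (hSA hS)))
  · intro σ hσ
    simp only [Finset.mem_product, Finset.mem_filter, Finset.mem_univ, true_and] at hσ ⊢
    refine ⟨fun v hv => ?_, fun v hv => hσ ⟨v, hA v.2⟩ (Or.inl hv)⟩
    split_ifs with hvA
    · rfl
    · exact hσ v (Or.inr (hv.resolve_left hvA))
  · rintro ⟨σ, τ⟩ hq
    simp only [Finset.mem_product, Finset.mem_filter, Finset.mem_univ, true_and] at hq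
    ext v
    · by_cases hvA : (v : Site d) ∈ A
      · simp only [hvA, if_true]
        exact (hq.1 v (Or.inl hvA)).symm
      · simp only [hvA, if_false, dif_neg, not_false_eq_true]
    · simp only [v.2, dif_pos]
  · intro σ _
    funext v
    by_cases hvA : (v : Site d) ∈ A
    · simp only [hvA, dif_pos]
    · simp only [hvA, if_false, dif_neg, not_false_eq_true]
  · rintro ⟨σ, τ⟩ hq
    simp only [Finset.mem_product, Finset.mem_filter, Finset.mem_univ, true_and] at hq ⊢
    set ρ : Λ → χ := fun v => if hv : (v : Site d) ∈ A then τ ⟨v, hv⟩ else σ v with hρ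
    rw [weight_eq_globalWeight_extend H h Λ ω σ, weight_eq_globalWeight_extend H h Λ ω ρ,
      weight_eq_globalWeight_extend H h A ω τ, globalWeight_eq_mul H h hA,
      globalWeight_eq_mul H h hA (extend _ _ ρ)]
    have e1 : globalWeight H h A (extend (Λ : Set (Site d)) ω σ) = globalWeight H h A ω :=
      globalWeight_congr H h fun v hv => by
        rw [extend_of_mem (D := (Λ : Set (Site d))) (hA hv)]
        exact hq.1 ⟨v, hA hv⟩ (Or.inl hv)
    have e2 : globalWeight H h A (extend (Λ : Set (Site d)) ω ρ) =
        globalWeight H h A (extend (A : Set (Site d)) ω τ) :=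
      globalWeight_congr H h fun v hv => by
        rw [extend_of_mem (D := (Λ : Set (Site d))) (hA hv),
          extend_of_mem (D := (A : Set (Site d))) hv]
        exact dif_pos hv
    have e3 : outerWeight H h A Λ (extend (Λ : Set (Site d)) ω σ) =
        outerWeight H h A Λ (extend (Λ : Set (Site d)) ω ρ) := by
      refine outerWeight_congr H h (fun v hv hvA => ?_) (fun v hv => ?_)
      · rw [extend_of_mem (D := (Λ : Set (Site d))) hv, extend_of_mem (D := (Λ : Set (Site d))) hv]
        simp only [hρ]
        rw [dif_neg hvA]
      · have hvA : v ∈ A := hv.1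
        rw [extend_of_mem (D := (Λ : Set (Site d))) (hA hvA),
          extend_of_mem (D := (Λ : Set (Site d))) (hA hvA)]
        refine (hq.1 ⟨v, hA hvA⟩ (Or.inl hvA)).trans ?_
        refine Eq.trans ?_ (dif_pos hvA).symm
        exact (hq.2 ⟨v, hvA⟩ (hbS hv)).symm
    rw [e1, e2, e3]
    ring

end

/-! ### Finite-volume Gibbs measures -/

section

variable {d : ℕ} {χ : Type*} (H : χ → χ → WithTop ℝ) (h : χ → ℝ) [Fintype χ]

theorem mass_eq_zero_of_globalWeight_eq_zero {A Λ : Finset (Site d)} (hA : A ⊆ Λ) {Y : Set (Site d)}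
    {ω : Site d → χ} (hω : globalWeight H h A ω = 0) :
    mass H h Λ (agree Λ (A ∪ Y) ω) = 0 := by
  by_contra hne
  obtain ⟨σ, hσ, hpos⟩ := exists_weight_pos_of_mass_ne_zero H h hne
  rw [weight_eq_globalWeight_extend H h Λ ω σ, globalWeight_eq_mul H h hA,
    globalWeight_congr H h (τ := ω), hω, zero_mul] at hpos
  · exact lt_irrefl _ hpos
  · intro v hv
    rw [extend_of_mem (D := (Λ : Set (Site d))) (hA hv)]
    exact hσ ⟨v, hA hv⟩ (Or.inl hv)

theorem globalWeight_le_mass {A : Finset (Site d)} {S : Set (Site d)} (ω : Site d → χ) :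
    globalWeight H h A ω ≤ mass H h A (agree A S ω) := by
  rw [← weight_restrict]
  exact weight_le_mass H h (σ := fun v : A => ω v) fun v _ => rfl

theorem condProb_agree_self {A : Finset (Site d)} {S : Set (Site d)} (ω : Site d → χ) :
    condProb H h A (agree A A ω) (agree A S ω) =
      globalWeight H h A ω / mass H h A (agree A S ω) := by
  unfold condProb
  rw [← mass_agree_self]
  congr 2
  exact Set.inter_eq_left.2 fun σ hσ v _ => hσ v v.2

variable [MeasurableSpace χ]

/-- The finite-volume Gibbs measure on `Λ`, conditioned on the spins in `Y` being `η`. -/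
def finiteGibbs (Λ : Finset (Site d)) (Y : Set (Site d)) (η : Site d → χ) :
    Measure (↥(Λ : Set (Site d)) → χ) :=
  ∑ σ : Λ → χ, ENNReal.ofReal ((agree (Λ : Set (Site d)) Y η).indicator (weight H h Λ) σ /
    mass H h Λ (agree Λ Y η)) • Measure.dirac (α := ↥(Λ : Set (Site d)) → χ) σ

variable [MeasurableSingletonClass χ]

theorem finiteGibbs_apply (Λ : Finset (Site d)) (Y : Set (Site d)) (η : Site d → χ)
    (E : Set (Λ → χ)) :
    finiteGibbs H h Λ Y η E = ENNReal.ofReal (condProb H h Λ E (agree Λ Y η)) := by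
  have hE : MeasurableSet (α := ↥(Λ : Set (Site d)) → χ) E :=
    (Set.toFinite (α := Λ → χ) E).measurableSet
  unfold finiteGibbs condProb
  rw [Measure.finsetSum_apply]
  unfold mass
  rw [Finset.sum_div, ENNReal.ofReal_sum_of_nonneg]
  · refine Finset.sum_congr rfl fun σ _ => ?_
    rw [Measure.smul_apply, Measure.dirac_apply' _ hE, smul_eq_mul]
    by_cases hσ : σ ∈ E
    · rw [Set.indicator_of_mem hσ, Pi.one_apply, mul_one]
      congr 2
      by_cases hσ' : σ ∈ agree (Λ : Set (Site d)) Y η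
      · rw [Set.indicator_of_mem hσ', Set.indicator_of_mem (Set.mem_inter hσ hσ')]
      · rw [Set.indicator_of_notMem hσ', Set.indicator_of_notMem fun hm => hσ' hm.2]
    · rw [Set.indicator_of_notMem hσ, mul_zero, Set.indicator_of_notMem fun hm => hσ hm.1,
        zero_div, ENNReal.ofReal_zero]
  · exact fun σ _ => div_nonneg (Set.indicator_nonneg (fun _ _ => weight_nonneg H h Λ _) σ)
      (mass_nonneg H h Λ _)

theorem finiteGibbs_real (Λ : Finset (Site d)) (Y : Set (Site d)) (η : Site d → χ)
    (E : Set (Λ → χ)) :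
    (finiteGibbs H h Λ Y η).real E = condProb H h Λ E (agree Λ Y η) := by
  rw [Measure.real, finiteGibbs_apply, ENNReal.toReal_ofReal (condProb_nonneg H h Λ _ _)]

theorem isGibbs_finiteGibbs {Λ : Finset (Site d)} {Y : Set (Site d)} {η : Site d → χ}
    (hne : mass H h Λ (agree Λ Y η) ≠ 0) :
    IsGibbs H h (Λ : Set (Site d)) Y η (finiteGibbs H h Λ Y η) where
  prob := by
    refine ⟨?_⟩
    rw [finiteGibbs_apply, condProb, Set.univ_inter, div_self hne, ENNReal.ofReal_one]
  fixed := by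
    rw [ae_iff]
    have : {σ | σ ∉ agree (Λ : Set (Site d)) Y η} = (agree (Λ : Set (Site d)) Y η)ᶜ := rfl
    rw [this, finiteGibbs_apply, condProb, Set.compl_inter_self]
    simp [mass]
  markov := by
    classical
    intro A hA ω
    have hA' : A ⊆ Λ := hA
    rw [finiteGibbs_real, finiteGibbs_real]
    -- If `ω` contradicts `η` on `Y ∩ A`, both sides vanish. Otherwise `ω` on `A` and `η` off `A`
    -- form one configuration `ω'`, to which the identity for masses applies.
    by_cases hω : ∀ v ∈ Y, v ∈ A → ω v = η v
    · set S := bdry (Λ : Set (Site d)) A ∪ (Y ∩ A) with hS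
      have hSA : S ⊆ A := Set.union_subset (fun v hv => hv.1) Set.inter_subset_right
      set ω' : Site d → χ := fun v => if v ∈ A then ω v else η v with hω'
      have hωA : ∀ v ∈ A, ω' v = ω v := fun v hv => if_pos hv
      have hωY : ∀ v ∈ Y, ω' v = η v := fun v hv => by
        by_cases hvA : v ∈ A
        · rw [hωA v hvA, hω v hv hvA]
        · exact if_neg hvA
      have key : ∀ T ⊆ (A : Set (Site d)), agree (Λ : Set (Site d)) T ω ∩ agree Λ Y η =
          agree Λ (T ∪ Y) ω' := by
        intro T hT
        ext σ
        constructor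
        · rintro ⟨h1, h2⟩ v (hv | hv)
          · rw [hωA v (hT hv)]; exact h1 v hv
          · rw [hωY v hv]; exact h2 v hv
        · intro hσ
          refine ⟨fun v hv => ?_, fun v hv => ?_⟩
          · rw [← hωA v (hT hv)]; exact hσ v (Or.inl hv)
          · rw [← hωY v hv]; exact hσ v (Or.inr hv)
      have hm : mass H h A (agree A S ω) = mass H h A (agree A S ω') := by
        congr 1
        ext σ
        refine forall₂_congr fun v hv => ?_
        rw [hωA v v.2]
      rw [condProb_agree_self, condProb, condProb, key A subset_rfl, key S hSA,
        ← globalWeight_congr H h hωA, hm]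
      have := mass_mul_mass_of_bdry_subset H h hA' (S := S) (Y := Y) Set.subset_union_left hSA
        Set.subset_union_right ω'
      -- Here the conditional probability on `A` is a division by zero; the left side is zero as
      -- well.
      by_cases h0 : mass H h A (agree A S ω') = 0
      · have hg : globalWeight H h A ω' = 0 :=
          le_antisymm (h0 ▸ globalWeight_le_mass H h ω') (globalWeight_nonneg H h A ω')
        rw [mass_eq_zero_of_globalWeight_eq_zero H h hA' hg, hg]
        simp
      · rw [div_mul_div_comm, div_eq_div_iff hne (mul_ne_zero h0 hne), ← this]
        ring
    · push Not at hω
      obtain ⟨v, hvY, hvA, hv⟩ := hω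
      have key : ∀ T : Set (Site d), v ∈ T →
          agree (Λ : Set (Site d)) T ω ∩ agree Λ Y η = ∅ := by
        intro T hT
        rw [Set.eq_empty_iff_forall_notMem]
        rintro σ ⟨h1, h2⟩
        exact hv ((h1 ⟨v, hA hvA⟩ hT).symm.trans (h2 ⟨v, hA hvA⟩ hvY))
      have h0 : ∀ T : Set (Site d), v ∈ T → condProb H h Λ (agree Λ T ω) (agree Λ Y η) = 0 := by
        intro T hT
        rw [condProb, key T hT]
        simp [mass]
      rw [h0 A hvA, h0 _ (Or.inr ⟨hvY, hvA⟩), mul_zero]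

end

/-! ### Cylinder events and conditioning on finitely many spins -/

/-- The restriction of a configuration on `D` to a finite subset of `D`. -/
def restrictTo {d : ℕ} {χ : Type*} {D : Set (Site d)} {A : Finset (Site d)}
    (hA : (A : Set (Site d)) ⊆ D) (σ : D → χ) : A → χ := fun v => σ ⟨v, hA v.2⟩

section

variable {d : ℕ} {χ : Type*}

theorem preimage_restrictTo_singleton {D : Set (Site d)} {A : Finset (Site d)}
    (hA : (A : Set (Site d)) ⊆ D) (η : Site d → χ) (τ : A → χ) :
    restrictTo hA ⁻¹' {τ} = agree D A (extend (A : Set (Site d)) η τ) := by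
  ext σ
  rw [Set.mem_preimage, Set.mem_singleton_iff, mem_agree]
  constructor
  · intro hσ v hv
    rw [extend_of_mem hv, ← hσ]
    rfl
  · intro hσ
    funext v
    have := hσ ⟨v, hA v.2⟩ v.2
    rw [extend_of_mem (D := (A : Set (Site d))) v.2] at this
    exact this

theorem agree_congr {D S : Set (Site d)} {τ τ' : Site d → χ} (hτ : ∀ v ∈ D, v ∈ S → τ v = τ' v) :
    agree D S τ = agree D S τ' := by
  ext σ
  refine forall₂_congr fun v hv => ?_
  rw [hτ v v.2 hv]

theorem preimage_restrictTo_agree {D S : Set (Site d)} {A : Finset (Site d)}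
    (hA : (A : Set (Site d)) ⊆ D) (hS : S ⊆ A) (τ : Site d → χ) :
    restrictTo hA ⁻¹' (agree A S τ) = agree D S τ := by
  ext σ
  exact ⟨fun hσ v hv => hσ ⟨v, hS hv⟩ hv, fun hσ v hv => hσ ⟨v, hA v.2⟩ hv⟩

variable [MeasurableSpace χ]

theorem measurable_restrictTo {D : Set (Site d)} {A : Finset (Site d)}
    (hA : (A : Set (Site d)) ⊆ D) : Measurable (restrictTo (χ := χ) hA) :=
  measurable_pi_lambda _ fun _ => measurable_pi_apply _

variable [MeasurableSingletonClass χ]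

theorem measurableSet_agree (D S : Set (Site d)) (τ : Site d → χ) :
    MeasurableSet (agree D S τ) := by
  have : agree D S τ = ⋂ v : D, ⋂ _ : (v : Site d) ∈ S, (fun σ : D → χ => σ v) ⁻¹' {τ v} := by
    ext σ
    simp [mem_agree]
  rw [this]
  exact MeasurableSet.iInter fun v => MeasurableSet.iInter fun _ =>
    measurable_pi_apply v (measurableSet_singleton _)

variable [Fintype χ]

theorem ext_of_agree {D : Set (Site d)} {μ ν : Measure (D → χ)} [IsProbabilityMeasure μ]
    [IsProbabilityMeasure ν]
    (hμν : ∀ A : Finset (Site d), (A : Set (Site d)) ⊆ D → ∀ ω : Site d → χ,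
      μ.real (agree D A ω) = ν.real (agree D A ω)) : μ = ν := by
  classical
  -- With no spins at all, `D → χ` has at most one point. Otherwise a default configuration is
  -- available to extend finite ones, and a measure is determined by its finite-dimensional
  -- marginals.
  by_cases hχ : Nonempty (Site d → χ)
  swap
  · have : IsEmpty χ := not_nonempty_iff.1 fun ⟨x⟩ => hχ ⟨fun _ => x⟩
    by_cases hD : D.Nonempty
    · obtain ⟨v, hv⟩ := hD
      have : IsEmpty (D → χ) := ⟨fun σ => isEmptyElim (σ ⟨v, hv⟩)⟩
      exact Measure.ext_of_singleton fun σ => isEmptyElim σ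
    · have : IsEmpty D := Set.isEmpty_coe_sort.2 (Set.not_nonempty_iff_eq_empty.1 hD)
      refine Measure.ext_of_singleton fun σ => ?_
      have : ({σ} : Set (D → χ)) = Set.univ := by
        ext τ; simp [Subsingleton.elim τ σ]
      rw [this, measure_univ, measure_univ]
  obtain ⟨η⟩ := hχ
  refine IsProjectiveLimit.unique (P := fun I : Finset D => ν.map I.restrict) (fun I => ?_)
    fun I => rfl
  refine Measure.ext_of_singleton fun τ => ?_
  rw [Measure.map_apply (Finset.measurable_restrict I) (measurableSet_singleton τ),
    Measure.map_apply (Finset.measurable_restrict I) (measurableSet_singleton τ)]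
  let ω : Site d → χ := fun v => if hv : ∃ hD : v ∈ D, (⟨v, hD⟩ : D) ∈ I then
    τ ⟨⟨v, hv.choose⟩, hv.choose_spec⟩ else η v
  have : I.restrict (π := fun _ => χ) ⁻¹' {τ} =
      agree D (I.map (Function.Embedding.subtype (· ∈ D)) : Finset (Site d)) ω := by
    ext σ
    rw [Set.mem_preimage, Set.mem_singleton_iff, mem_agree]
    have hω : ∀ v : I, ω v = τ v := by
      intro v
      have hv : ∃ hD : (v : Site d) ∈ D, (⟨v, hD⟩ : D) ∈ I := ⟨v.1.2, v.2⟩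
      exact dif_pos hv
    constructor
    · rintro rfl v hv
      have hvI : v ∈ I := by simpa using hv
      exact (hω ⟨v, hvI⟩).symm
    · intro hσ
      funext v
      rw [← hω v]
      exact hσ v (by simp)
  rw [this, ← measureReal_eq_measureReal_iff]
  refine hμν _ (fun v hv => ?_) ω
  simp only [Finset.coe_map, Set.mem_image] at hv
  obtain ⟨w, -, rfl⟩ := hv
  exact w.2

/-- A probability may be bounded by conditioning on a variable with finitely many values. -/
theorem measureReal_le_of_fibers {Ω β : Type*} [MeasurableSpace Ω] [Fintype β] [MeasurableSpace β]
    [MeasurableSingletonClass β] {μ : Measure Ω} [IsProbabilityMeasure μ] {f : Ω → β}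
    (hf : Measurable f) {E : Set Ω} {c : ℝ}
    (hc : ∀ b, μ.real (E ∩ f ⁻¹' {b}) ≤ c * μ.real (f ⁻¹' {b})) : μ.real E ≤ c := by
  have hm : ∀ b, MeasurableSet (f ⁻¹' {b}) := fun b => hf (measurableSet_singleton b)
  have h1 := sum_measureReal_preimage_singleton (μ := μ.restrict E) Finset.univ fun b _ => hm b
  have h2 := sum_measureReal_preimage_singleton (μ := μ) Finset.univ fun b _ => hm b
  simp only [Finset.coe_univ, Set.preimage_univ, probReal_univ,
    measureReal_restrict_apply_univ] at h1 h2
  rw [← h1, ← mul_one c, ← h2, Finset.mul_sum]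
  refine Finset.sum_le_sum fun b _ => ?_
  rw [measureReal_restrict_apply (hm b), Set.inter_comm]
  exact hc b

theorem le_measureReal_of_fibers {Ω β : Type*} [MeasurableSpace Ω] [Fintype β] [MeasurableSpace β]
    [MeasurableSingletonClass β] {μ : Measure Ω} [IsProbabilityMeasure μ] {f : Ω → β}
    (hf : Measurable f) {E : Set Ω} {c : ℝ}
    (hc : ∀ b, c * μ.real (f ⁻¹' {b}) ≤ μ.real (E ∩ f ⁻¹' {b})) : c ≤ μ.real E := by
  have hm : ∀ b, MeasurableSet (f ⁻¹' {b}) := fun b => hf (measurableSet_singleton b)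
  have h1 := sum_measureReal_preimage_singleton (μ := μ.restrict E) Finset.univ fun b _ => hm b
  have h2 := sum_measureReal_preimage_singleton (μ := μ) Finset.univ fun b _ => hm b
  simp only [Finset.coe_univ, Set.preimage_univ, probReal_univ,
    measureReal_restrict_apply_univ] at h1 h2
  rw [← h1, ← mul_one c, ← h2, Finset.mul_sum]
  refine Finset.sum_le_sum fun b _ => ?_
  rw [measureReal_restrict_apply (hm b), Set.inter_comm]
  exact hc b

end

/-! ### Gibbs measures under strong spatial mixing -/

section

variable {d : ℕ} {χ : Type*} {H : χ → χ → WithTop ℝ} {h : χ → ℝ} [Fintype χ] [MeasurableSpace χ]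
  {D Y : Set (Site d)} {η : Site d → χ} {ν : Measure (D → χ)}

theorem IsGibbs.eq_of_real_ne_zero (hν : IsGibbs H h D Y η ν) {S : Set (Site d)} {τ : Site d → χ}
    (hτ : ν.real (agree D S τ) ≠ 0) {v : Site d} (hvD : v ∈ D) (hvS : v ∈ S) (hvY : v ∈ Y) :
    τ v = η v := by
  by_contra hne
  apply hτ
  rw [measureReal_def, measure_mono_null, ENNReal.toReal_zero]
  rotate_left
  · exact ae_iff.1 hν.fixed
  · intro σ hσ hσ'
    exact hne ((hσ ⟨v, hvD⟩ hvS).symm.trans (hσ' ⟨v, hvD⟩ hvY))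

variable [MeasurableSingletonClass χ]

/-- The field `markov` speaks of single configurations on `A`; summing it over `E` is possible
because all members of `E` have the same boundary values, hence the same denominator. -/
theorem IsGibbs.real_preimage (hν : IsGibbs H h D Y η ν) {A : Finset (Site d)}
    (hA : (A : Set (Site d)) ⊆ D) {τ : Site d → χ} {E : Set (A → χ)}
    (hE : E ⊆ agree A (bdry D A ∪ (Y ∩ A)) τ) :
    ν.real (restrictTo hA ⁻¹' E) =
      mass H h A E / mass H h A (agree A (bdry D A ∪ (Y ∩ A)) τ) *
        ν.real (agree D (bdry D A ∪ (Y ∩ A)) τ) := by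
  classical
  have := hν.prob
  have hsum := sum_measureReal_preimage_singleton (μ := ν) (f := restrictTo hA)
    (Set.toFinite E).toFinset fun σ _ => measurable_restrictTo hA (measurableSet_singleton σ)
  rw [Set.Finite.coe_toFinset] at hsum
  rw [← hsum, mass, Finset.sum_div, Finset.sum_mul]
  have hsub : bdry D A ∪ (Y ∩ A) ⊆ (A : Set (Site d)) :=
    Set.union_subset (fun v hv => hv.1) Set.inter_subset_right
  rw [← Finset.sum_subset (Finset.subset_univ (Set.toFinite E).toFinset)]
  · refine Finset.sum_congr rfl fun σ hσ => ?_
    rw [Set.Finite.mem_toFinset] at hσ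
    rw [preimage_restrictTo_singleton hA η, hν.markov A hA, condProb_agree_self,
      Set.indicator_of_mem hσ, weight_eq_globalWeight_extend H h A η]
    have hτ : ∀ v ∈ bdry D A ∪ (Y ∩ A), extend (A : Set (Site d)) η σ v = τ v := by
      intro v hv
      rw [extend_of_mem (hsub hv)]
      exact hE hσ ⟨v, hsub hv⟩ hv
    rw [agree_congr (D := A) fun v _ => hτ v, agree_congr (D := D) fun v _ => hτ v]
  · intro σ _ hσ
    rw [Set.Finite.mem_toFinset] at hσ
    rw [Set.indicator_of_notMem hσ, zero_div, zero_mul]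

/-- The spatial Markov property when the spins are given on a larger set. -/
theorem IsGibbs.real_inter_agree (hν : IsGibbs H h D Y η ν) {A : Finset (Site d)}
    (hA : (A : Set (Site d)) ⊆ D) {S : Set (Site d)} (hbS : bdry D A ⊆ S) (hYS : Y ∩ A ⊆ S)
    (hSA : S ⊆ A) {X : Set (Site d)} (hX : X ⊆ A) (ω τ : Site d → χ) :
    ν.real (agree D X ω ∩ agree D S τ) =
      condProb H h A (agree A X ω) (agree A S τ) * ν.real (agree D S τ) := by
  have hsub : agree (A : Set (Site d)) S τ ⊆ agree A (bdry D A ∪ (Y ∩ A)) τ :=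
    fun σ hσ v hv => hσ v (hv.elim (fun hv => hbS hv) (fun hv => hYS hv))
  have h1 := hν.real_preimage hA hsub
  have h2 := hν.real_preimage hA (Set.inter_subset_right.trans hsub : agree A X ω ∩ _ ⊆ _)
  rw [Set.preimage_inter, preimage_restrictTo_agree hA hX, preimage_restrictTo_agree hA hSA] at h2
  rw [preimage_restrictTo_agree hA hSA] at h1
  rw [h1, h2, condProb]
  by_cases h0 : mass H h A (agree A S τ) = 0
  · have h0' : mass H h A (agree A X ω ∩ agree A S τ) = 0 :=
      le_antisymm (h0 ▸ mass_mono H h Set.inter_subset_right) (mass_nonneg H h A _)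
    rw [h0, h0']
    simp
  · field_simp

theorem IsGibbs.mass_ne_zero (hν : IsGibbs H h D Y η ν) {A : Finset (Site d)}
    (hA : (A : Set (Site d)) ⊆ D) {S : Set (Site d)} (hbS : bdry D A ⊆ S) (hYS : Y ∩ A ⊆ S)
    (hSA : S ⊆ A) {τ : Site d → χ} (hτ : ν.real (agree D S τ) ≠ 0) :
    mass H h A (agree A S τ) ≠ 0 := by
  intro h0
  have := hν.real_inter_agree hA hbS hYS hSA hSA τ τ
  rw [Set.inter_self, condProb, h0, div_zero, zero_mul] at this
  exact hτ this

/-- The probability is an average of conditional probabilities given the spins on `S`. Only values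
of positive probability enter, and these agree with `η` on `Y` and make the finite-volume
conditioning well defined. -/
theorem IsGibbs.real_le (hν : IsGibbs H h D Y η ν) {A S : Finset (Site d)}
    (hA : (A : Set (Site d)) ⊆ D) (hbS : bdry D A ⊆ S) (hYS : Y ∩ A ⊆ S)
    (hSA : S ⊆ A) {X : Set (Site d)} (hX : X ⊆ A) (ω : Site d → χ) {c : ℝ}
    (hc : ∀ τ : Site d → χ, (∀ v ∈ Y, v ∈ A → τ v = η v) → mass H h A (agree A S τ) ≠ 0 →
      condProb H h A (agree A X ω) (agree A S τ) ≤ c) : ν.real (agree D X ω) ≤ c := by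
  have := hν.prob
  have hSA' : (S : Set (Site d)) ⊆ A := hSA
  refine measureReal_le_of_fibers (measurable_restrictTo (hSA'.trans hA)) fun b => ?_
  rw [preimage_restrictTo_singleton _ η, hν.real_inter_agree hA hbS hYS hSA' hX]
  by_cases h0 : ν.real (agree D S (extend (S : Set (Site d)) η b)) = 0
  · rw [h0, mul_zero, mul_zero]
  · refine mul_le_mul_of_nonneg_right (hc _ (fun v hvY hvA => ?_) ?_) measureReal_nonneg
    · exact hν.eq_of_real_ne_zero h0 (hA hvA) (hYS ⟨hvY, hvA⟩) hvY
    · exact hν.mass_ne_zero hA hbS hYS hSA' h0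

theorem IsGibbs.le_real (hν : IsGibbs H h D Y η ν) {A S : Finset (Site d)}
    (hA : (A : Set (Site d)) ⊆ D) (hbS : bdry D A ⊆ S) (hYS : Y ∩ A ⊆ S)
    (hSA : S ⊆ A) {X : Set (Site d)} (hX : X ⊆ A) (ω : Site d → χ) {c : ℝ}
    (hc : ∀ τ : Site d → χ, (∀ v ∈ Y, v ∈ A → τ v = η v) → mass H h A (agree A S τ) ≠ 0 →
      c ≤ condProb H h A (agree A X ω) (agree A S τ)) : c ≤ ν.real (agree D X ω) := by
  have := hν.prob
  have hSA' : (S : Set (Site d)) ⊆ A := hSA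
  refine le_measureReal_of_fibers (measurable_restrictTo (hSA'.trans hA)) fun b => ?_
  rw [preimage_restrictTo_singleton _ η, hν.real_inter_agree hA hbS hYS hSA' hX]
  by_cases h0 : ν.real (agree D S (extend (S : Set (Site d)) η b)) = 0
  · rw [h0, mul_zero, mul_zero]
  · refine mul_le_mul_of_nonneg_right (hc _ (fun v hvY hvA => ?_) ?_) measureReal_nonneg
    · exact hν.eq_of_real_ne_zero h0 (hA hvA) (hYS ⟨hvY, hvA⟩) hvY
    · exact hν.mass_ne_zero hA hbS hYS hSA' h0

theorem bdry_mono_left {D D' A : Set (Site d)} (hD : D ⊆ D') : bdry D A ⊆ bdry D' A :=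
  fun _ ⟨hv, u, hu, huv⟩ => ⟨hv, u, hD hu, huv⟩

theorem subset_ball (X : Finset (Site d)) (r : ℕ) : X ⊆ ball X r :=
  fun v hv => mem_ball.2 ⟨v, hv, by simp [l1]⟩

/-- Under strong spatial mixing, two Gibbs measures on graphs that both contain `B_r(X)` are close
on `X`. -/
theorem IsGibbs.abs_real_sub_le {D' : Set (Site d)} {ν' : Measure (D' → χ)}
    (hν : IsGibbs H h D Y η ν) (hν' : IsGibbs H h D' Y η ν') {X : Finset (Site d)} {R : ℕ → ℝ}
    (hR : IsSSMRate H h X Y R) {r : ℕ} (hr : 1 ≤ r) (hD : (ball X r : Set (Site d)) ⊆ D)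
    (hD' : (ball X r : Set (Site d)) ⊆ D') (ω : Site d → χ) :
    |ν.real (agree D X ω) - ν'.real (agree D' X ω)| ≤ R r := by
  classical
  set A := ball X r
  -- The boundary is taken in `ℤ^d`, as in the mixing condition. It contains the boundaries relative
  -- to `D` and to `D'`, so that one set serves both measures.
  set S : Finset (Site d) := A.filter fun v => v ∈ bdry Set.univ (A : Set (Site d)) ∨ v ∈ Y with hS
  have hSA : S ⊆ A := Finset.filter_subset _ _
  have hbS : ∀ D : Set (Site d), bdry D A ⊆ S := fun D v hv =>
    Finset.mem_filter.2 ⟨hv.1, Or.inl (bdry_mono_left (Set.subset_univ D) hv)⟩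
  have hYS : Y ∩ A ⊆ S := fun v hv => Finset.mem_filter.2 ⟨hv.2, Or.inr hv.1⟩
  have hXA : (X : Set (Site d)) ⊆ A := subset_ball X r
  have hev : ∀ τ : Site d → χ, (∀ v ∈ Y, v ∈ A → τ v = η v) →
      ssmEvent X Y r η τ = agree A S τ := by
    intro τ hτ
    ext σ
    constructor
    · rintro ⟨h1, h2⟩ v hv
      rcases (Finset.mem_filter.1 hv).2 with hb | hY
      · exact h2 v hb
      · rw [hτ v hY v.2]; exact h1 v hY
    · intro hσ
      refine ⟨fun v hv => ?_, fun v hv => ?_⟩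
      · rw [← hτ v hv v.2]; exact hσ v (hYS ⟨hv, v.2⟩)
      · exact hσ v (hbS _ hv)
  have hclose : ∀ τ τ' : Site d → χ, (∀ v ∈ Y, v ∈ A → τ v = η v) →
      (∀ v ∈ Y, v ∈ A → τ' v = η v) → mass H h A (agree A S τ) ≠ 0 →
      mass H h A (agree A S τ') ≠ 0 →
      condProb H h A (agree A X ω) (agree A S τ) ≤
        condProb H h A (agree A X ω) (agree A S τ') + R r := by
    intro τ τ' hτ hτ' h0 h0'
    have := hR r hr ω η τ τ' (by rwa [hev τ hτ]) (by rwa [hev τ' hτ'])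
    rw [hev τ hτ, hev τ' hτ'] at this
    exact sub_le_iff_le_add'.1 (abs_le.1 this).2
  -- For each pair of admissible boundary values the conditional probabilities differ by at most `R
  -- r`. Averaging over the values of one measure and then of the other keeps this bound.
  rw [abs_le]
  constructor
  · have : ν'.real (agree D' X ω) ≤ ν.real (agree D X ω) + R r := by
      refine hν'.real_le hD' (hbS _) hYS hSA hXA ω fun τ' hτ' h0' => ?_
      have : condProb H h A (agree A X ω) (agree A S τ') - R r ≤ ν.real (agree D X ω) :=
        hν.le_real hD (hbS _) hYS hSA hXA ω fun τ hτ h0 => by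
          linarith [hclose τ' τ hτ' hτ h0' h0]
      linarith
    linarith
  · have : ν.real (agree D X ω) ≤ ν'.real (agree D' X ω) + R r := by
      refine hν.real_le hD (hbS _) hYS hSA hXA ω fun τ' hτ' h0' => ?_
      have : condProb H h A (agree A X ω) (agree A S τ') - R r ≤ ν'.real (agree D' X ω) :=
        hν'.le_real hD' (hbS _) hYS hSA hXA ω fun τ hτ h0 => by
          linarith [hclose τ' τ hτ' hτ h0' h0]
      linarith
    linarith

/-- Strong spatial mixing implies that there is at most one Gibbs measure on `ℤ^d`. -/
theorem IsGibbs.eq_of_ssm (hSSM : SSM d H h) {μ ν : Measure (↥(Set.univ : Set (Site d)) → χ)}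
    (hμ : IsGibbs H h Set.univ Y η μ) (hν : IsGibbs H h Set.univ Y η ν) : μ = ν := by
  have := hμ.prob
  have := hν.prob
  refine ext_of_agree fun X _ ω => ?_
  obtain ⟨R, hR0, hR⟩ := hSSM X Y
  have hle : |μ.real (agree Set.univ X ω) - ν.real (agree Set.univ X ω)| ≤ 0 := by
    refine ge_of_tendsto hR0 ?_
    filter_upwards [eventually_ge_atTop 1] with r hr
    exact hμ.abs_real_sub_le hν hR hr (Set.subset_univ _) (Set.subset_univ _) ω
  exact sub_eq_zero.1 (abs_nonpos_iff.1 hle)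

end

/-! ### A uniform lower bound for the probability of a compatible spin -/

section

variable {d : ℕ}

theorem l1_comm (u v : Site d) : l1 u v = l1 v u := by
  unfold l1
  exact Finset.sum_congr rfl fun i _ => by omega

theorem l1_triangle (u v w : Site d) : l1 u w ≤ l1 u v + l1 v w := by
  unfold l1
  rw [← Finset.sum_add_distrib]
  exact Finset.sum_le_sum fun i _ => by omega

theorem exists_pos_le_of_finite {ι : Type*} [Finite ι] {f : ι → ℝ} (hf : ∀ i, 0 < f i) :
    ∃ c > 0, ∀ i, c ≤ f i := by
  rcases isEmpty_or_nonempty ι with hι | hι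
  · exact ⟨1, one_pos, fun i => isEmptyElim i⟩
  · obtain ⟨i, hi⟩ := Finite.exists_min f
    exact ⟨f i, hf i, hi⟩

variable {χ : Type*} {H : χ → χ → WithTop ℝ} {h : χ → ℝ}

/-- The only factors that change are those of edges at `v`, and they become finite-energy factors.
Symmetry of `H` is needed because `v` may be the first endpoint. -/
theorem globalWeight_update_pos (hsymm : ∀ s t, H s t = H t s) {s : χ} (hs : ∀ t, H t s ≠ ⊤)
    {Λ : Finset (Site d)} {σ : Site d → χ} (hσ : 0 < globalWeight H h Λ σ) (v : Site d) :
    0 < globalWeight H h Λ (Function.update σ v s) := by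
  have hne : ∏ p ∈ Λ ×ˢ Λ, pairFactor H σ p ≠ 0 := left_ne_zero_of_mul hσ.ne'
  rw [Finset.prod_ne_zero_iff] at hne
  refine mul_pos (Finset.prod_pos fun p hp => ?_) (Finset.prod_pos fun _ _ => Real.exp_pos _)
  refine lt_of_le_of_ne (pairFactor_nonneg _ _ _) fun h0 => hne p hp ?_
  unfold pairFactor at h0 ⊢
  split_ifs at h0 ⊢ with hp'
  · by_cases h1 : p.1 = v
    · rw [h1, Function.update_self, hsymm] at h0
      exact absurd h0 (boltzmann_pos (hs _)).ne
    · by_cases h2 : p.2 = v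
      · rw [h2, Function.update_self] at h0
        exact absurd h0 (boltzmann_pos (hs _)).ne
      · rw [Function.update_of_ne h1, Function.update_of_ne h2] at h0
        exact h0.symm
  · exact absurd h0 zero_ne_one

variable [Fintype χ]

theorem condProb_update_pos (hsymm : ∀ s t, H s t = H t s) {s : χ} (hs : ∀ t, H t s ≠ ⊤)
    {A : Finset (Site d)} {S : Set (Site d)} {v : Site d} (hv : v ∉ S) {τ : Site d → χ}
    (h0 : mass H h A (agree A S τ) ≠ 0) :
    0 < condProb H h A (agree A {v} fun _ => s) (agree A S τ) := by
  classical
  refine div_pos ?_ (lt_of_le_of_ne (mass_nonneg H h A _) h0.symm)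
  obtain ⟨σ, hσ, hpos⟩ := exists_weight_pos_of_mass_ne_zero H h h0
  rw [weight_eq_globalWeight_extend H h A τ] at hpos
  have := globalWeight_update_pos hsymm hs hpos v
  rw [← weight_restrict] at this
  refine this.trans_le (weight_le_mass H h ⟨?_, ?_⟩)
  · rintro u rfl
    exact Function.update_self _ _ _
  · intro u hu
    have huv : (u : Site d) ≠ v := fun huv => hv (huv ▸ hu)
    simp only [Function.update_of_ne huv]
    rw [extend_of_mem u.2]
    exact hσ u hu

variable [MeasurableSpace χ] [MeasurableSingletonClass χ]

/-- The spin at the origin takes a value compatible with all spins with a probability that is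
bounded below uniformly in the graph. -/
theorem exists_pos_le_real_agree (hsymm : ∀ s t, H s t = H t s) {s : χ} (hs : ∀ t, H t s ≠ ⊤)
    {Y : Set (Site d)} (hY : 0 ∉ Y) (η : Site d → χ) :
    ∃ c > 0, ∀ D : Set (Site d), 0 ∈ D → ∀ ν : Measure (D → χ), IsGibbs H h D Y η ν →
      c ≤ ν.real (agree D {0} fun _ => s) := by
  classical
  let f (A : Finset (Site d)) (τ : A → χ) : ℝ := condProb H h A
    (agree (A : Set (Site d)) {0} fun _ => s)
    (agree A ((A.erase 0 : Finset (Site d)) : Set (Site d)) (extend (A : Set (Site d)) η τ))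
  -- Given all its neighbours, the spin at the origin depends only on the part of the unit ball that
  -- lies in `D` and on the spins there. These are finitely many cases, so the positive values of
  -- `f` have a positive minimum.
  let I := Σ A : (ball {(0 : Site d)} 1).powerset, {τ : A.1 → χ // 0 < f A.1 τ}
  have : Finite I := Finite.instSigma
  obtain ⟨c, hc, hcf⟩ := exists_pos_le_of_finite (ι := I) (f := fun i => f i.1.1 i.2.1)
    fun i => i.2.2
  refine ⟨c, hc, fun D hD ν hν => ?_⟩
  set A : Finset (Site d) := (ball {0} 1).filter (· ∈ D) with hA
  have h0A : (0 : Site d) ∈ A := Finset.mem_filter.2 ⟨subset_ball _ _ (by simp), hD⟩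
  have hAD : (A : Set (Site d)) ⊆ D := fun v hv => (Finset.mem_filter.1 hv).2
  refine hν.le_real (S := A.erase 0) hAD ?_ ?_ (Finset.erase_subset _ _) (by simpa using h0A) _ ?_
  · rintro v ⟨hv, u, hu, hvu, huA⟩
    refine Finset.mem_coe.2 (Finset.mem_erase.2 ⟨?_, hv⟩)
    rintro rfl
    refine huA (Finset.mem_coe.2 (Finset.mem_filter.2 ⟨mem_ball.2 ⟨0, by simp, ?_⟩, hu⟩))
    exact (adj_comm.1 hvu).le
  · rintro v ⟨hvY, hv⟩
    refine Finset.mem_coe.2 (Finset.mem_erase.2 ⟨?_, hv⟩)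
    rintro rfl
    exact hY hvY
  · intro τ _ h0
    have hpos := condProb_update_pos hsymm hs (v := 0) (by simp) h0
    have he : agree (A : Set (Site d)) ((A.erase 0 : Finset (Site d)) : Set (Site d)) τ =
        agree A ((A.erase 0 : Finset (Site d)) : Set (Site d))
          (extend (A : Set (Site d)) η fun v : A => τ v) :=
      agree_congr fun v hv _ => by rw [extend_of_mem hv]
    rw [he] at hpos ⊢
    exact hcf ⟨⟨A, Finset.mem_powerset.2 (Finset.filter_subset _ _)⟩, ⟨fun v => τ v, hpos⟩⟩

end

/-! ### Compactness and local limits -/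

section

variable {d : ℕ} {χ : Type*} {H : χ → χ → WithTop ℝ} {h : χ → ℝ} [Fintype χ]
  [MeasurableSpace χ] [MeasurableSingletonClass χ]

theorem bdry_congr {D D' : Set (Site d)} {A : Set (Site d)} {m : ℕ} (hA : ∀ v ∈ A, l1 v 0 + 1 ≤ m)
    (hD : ∀ u, l1 u 0 ≤ m → (u ∈ D' ↔ u ∈ D)) : bdry D' A = bdry D A := by
  ext v
  refine and_congr_right fun hv => exists_congr fun u => ?_
  constructor
  · rintro ⟨hu, huv, hn⟩
    refine ⟨(hD u ?_).1 hu, huv, hn⟩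
    have := l1_triangle u v 0
    have h2 : l1 u v = 1 := adj_comm.1 huv
    have := hA v hv
    omega
  · rintro ⟨hu, huv, hn⟩
    refine ⟨(hD u ?_).2 hu, huv, hn⟩
    have := l1_triangle u v 0
    have h2 : l1 u v = 1 := adj_comm.1 huv
    have := hA v hv
    omega

theorem exists_l1_bound (A : Finset (Site d)) : ∃ m, ∀ v ∈ A, l1 v 0 + 1 ≤ m :=
  ⟨A.sup (fun v => l1 v 0) + 1, fun v hv => by
    have := Finset.le_sup (f := fun v : Site d => l1 v 0) hv
    simpa using this⟩

/-- Limits of Gibbs measures on graphs that locally converge to `D` are Gibbs measures on `D`. -/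
theorem exists_isGibbs_limit {D Y : Set (Site d)} {η : Site d → χ} {D' : ℕ → Set (Site d)}
    {ν' : ∀ m, Measure (D' m → χ)} (hν' : ∀ m, IsGibbs H h (D' m) Y η (ν' m))
    (hD : ∀ m u, l1 u 0 ≤ m → (u ∈ D' m ↔ u ∈ D)) :
    ∃ ν : Measure (D → χ), IsGibbs H h D Y η ν ∧ ∃ U : Ultrafilter ℕ, (U : Filter ℕ) ≤ atTop ∧
      ∀ X : Finset (Site d), (X : Set (Site d)) ⊆ D → ∀ ω : Site d → χ,
        Tendsto (fun m => (ν' m).real (agree (D' m) X ω)) U (𝓝 (ν.real (agree D X ω))) := by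
  classical
  let _ : TopologicalSpace χ := ⊥
  have : DiscreteTopology χ := ⟨rfl⟩
  have : BorelSpace χ := ⟨by
    rw [borel_eq_top_of_discrete]
    exact top_le_iff.1 fun s _ => (Set.toFinite s).measurableSet⟩
  have hprob := fun m => (hν' m).prob
  -- All measures are moved to the one compact space `D → χ`. The filling by `η` at sites missing
  -- from `D' m` is irrelevant, since any given finite set lies within `D' m` eventually.
  let e (m : ℕ) (σ : D' m → χ) : D → χ := fun v => extend (D' m) η σ v
  have he : ∀ m, Measurable (e m) := fun m => by
    refine measurable_pi_lambda _ fun v => ?_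
    by_cases hv : (v : Site d) ∈ D' m
    · simp only [e, extend_of_mem hv]
      exact measurable_pi_apply _
    · simp only [e, extend_of_notMem hv]
      exact measurable_const
  let P (m : ℕ) : ProbabilityMeasure (D → χ) :=
    ⟨(ν' m).map (e m), Measure.isProbabilityMeasure_map (he m).aemeasurable⟩
  let U : Ultrafilter ℕ := hyperfilter ℕ
  have hU : (U : Filter ℕ) ≤ atTop := Nat.hyperfilter_le_atTop
  let Q : ProbabilityMeasure (D → χ) := (U.map P).lim
  have hPQ : Tendsto P U (𝓝 Q) := (U.map P).le_nhds_lim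
  have hreal : ∀ X : Finset (Site d), (X : Set (Site d)) ⊆ D → ∀ ω : Site d → χ,
      ∀ m, (∀ v ∈ X, l1 v 0 + 1 ≤ m) →
        (P m : Measure (D → χ)).real (agree D X ω) = (ν' m).real (agree (D' m) X ω) := by
    intro X hX ω m hm
    rw [measureReal_def, measureReal_def]
    congr 1
    refine (Measure.map_apply (he m) (measurableSet_agree _ _ _)).trans ?_
    congr 1
    ext σ
    have hmem : ∀ v ∈ X, v ∈ D' m := fun v hv =>
      (hD m v (by have := hm v hv; omega)).2 (hX hv)
    constructor
    · intro hσ v hv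
      have := hσ ⟨v, hX hv⟩ hv
      simpa only [e, extend_of_mem (hmem v hv)] using this
    · intro hσ v hv
      simp only [e, extend_of_mem (hmem v hv)]
      exact hσ ⟨v, hmem v hv⟩ hv
  have hlim : ∀ X : Finset (Site d), (X : Set (Site d)) ⊆ D → ∀ ω : Site d → χ,
      Tendsto (fun m => (ν' m).real (agree (D' m) X ω)) U
        (𝓝 ((Q : Measure (D → χ)).real (agree D X ω))) := by
    intro X hX ω
    -- Events that depend on finitely many spins have empty frontier, so weak convergence gives
    -- convergence of their probabilities.
    have hclopen : IsClopen (agree D X ω) := by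
      have : agree D (X : Set (Site d)) ω =
          ⋂ v ∈ X.attach, (fun σ : D → χ => σ ⟨v, hX v.2⟩) ⁻¹' {ω v} := by
        ext σ
        simp only [Set.mem_iInter, Set.mem_preimage, Set.mem_singleton_iff]
        exact ⟨fun hσ v _ => hσ ⟨v, hX v.2⟩ v.2, fun hσ v hv => hσ ⟨v, hv⟩ (Finset.mem_attach _ _)⟩
      rw [this]
      exact isClopen_biInter_finset fun v _ => (isClopen_discrete _).preimage (continuous_apply _)
    have h1 := ProbabilityMeasure.tendsto_measure_of_null_frontier_of_tendsto' hPQ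
      (E := agree D X ω) (by rw [hclopen.frontier_eq, measure_empty])
    have h2 := (ENNReal.tendsto_toReal (measure_ne_top _ _)).comp h1
    refine h2.congr' ?_
    obtain ⟨m₀, hm₀⟩ := exists_l1_bound X
    filter_upwards [hU (eventually_ge_atTop m₀)] with m hm
    exact hreal X hX ω m fun v hv => (hm₀ v hv).trans hm
  refine ⟨Q, ⟨inferInstance, ?_, ?_⟩, U, hU, hlim⟩
  · have : ∀ v : D, ∀ᵐ σ ∂(Q : Measure (D → χ)), (v : Site d) ∈ Y → σ v = η v := by
      intro v
      by_cases hv : (v : Site d) ∈ Y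
      · have hone :
            (Q : Measure (D → χ)).real (agree D ({(v : Site d)} : Finset (Site d)) η) = 1 := by
          refine tendsto_nhds_unique (hlim {(v : Site d)} (by simp) η) ?_
          refine tendsto_const_nhds.congr fun m => ?_
          have : agree (D' m) (({(v : Site d)} : Finset (Site d)) : Set (Site d)) η =ᵐ[ν' m]
              Set.univ := by
            rw [eventuallyEq_univ]
            filter_upwards [(hν' m).fixed] with σ hσ w hw
            have hwv : (w : Site d) = v := by simpa using hw
            exact hσ w (hwv ▸ hv)
          rw [measureReal_congr this, probReal_univ]
        have hae := (prob_compl_eq_zero_iff (measurableSet_agree _ _ _)).2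
          ((ENNReal.toReal_eq_one_iff _).1 hone)
        rw [← mem_ae_iff] at hae
        filter_upwards [hae] with σ hσ _
        exact hσ v (by simp)
      · exact ae_of_all _ fun σ hv' => absurd hv' hv
    exact ae_all_iff.2 this
  · intro A hA ω
    set S : Set (Site d) := bdry D A ∪ (Y ∩ A) with hS
    have hSA : S ⊆ A := Set.union_subset (fun v hv => hv.1) Set.inter_subset_right
    obtain ⟨S', hS'⟩ : ∃ S' : Finset (Site d), (S' : Set (Site d)) = S :=
      (A.finite_toSet.subset hSA).exists_finset_coe
    refine tendsto_nhds_unique (hlim A hA ω) ?_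
    have h2 := (hlim S' (hS' ▸ hSA.trans hA) ω).const_mul
      (condProb H h A (agree A A ω) (agree A S ω))
    rw [hS'] at h2
    refine h2.congr' ?_
    obtain ⟨m₀, hm₀⟩ := exists_l1_bound A
    filter_upwards [hU (eventually_ge_atTop m₀)] with m hm
    have hm' : ∀ v ∈ A, l1 v 0 + 1 ≤ m := fun v hv => (hm₀ v hv).trans hm
    rw [(hν' m).markov A (fun v hv => (hD m v (by have := hm' v hv; omega)).2 (hA hv)) ω,
      bdry_congr hm' (hD m)]

/-- If the model on `D` has a unique Gibbs measure, then the Gibbs measures on graphs that look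
like `D` near the origin are close to it. -/
theorem exists_abs_real_sub_lt {D Y : Set (Site d)} {η : Site d → χ} {μ : Measure (D → χ)}
    (hμ : ∀ ν, IsGibbs H h D Y η ν → ν = μ) {X : Finset (Site d)} (hX : (X : Set (Site d)) ⊆ D)
    (ω : Site d → χ) {ε : ℝ} (hε : 0 < ε) :
    ∃ M : ℕ, ∀ D' : Set (Site d), (∀ u, l1 u 0 ≤ M → (u ∈ D' ↔ u ∈ D)) →
      ∀ ν : Measure (D' → χ), IsGibbs H h D' Y η ν →
        |ν.real (agree D' X ω) - μ.real (agree D X ω)| < ε := by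
  -- Otherwise there is a counterexample for every radius. A limit of these is a Gibbs measure on
  -- `D`, hence `μ`, although the probabilities stay at distance `ε`.
  by_contra! hcon
  choose D' hD' ν' hν' hfar using hcon
  obtain ⟨ν, hν, U, -, hlim⟩ := exists_isGibbs_limit hν' hD'
  have := hlim X hX ω
  rw [hμ ν hν] at this
  have h0 : Tendsto (fun m => |(ν' m).real (agree (D' m) X ω) - μ.real (agree D X ω)|) U (𝓝 0) := by
    simpa using (this.sub_const (μ.real (agree D X ω))).abs
  exact absurd (ge_of_tendsto' h0 hfar) (not_le.2 hε)

end

/-! ### Translations, the edge count and the telescoping formula -/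

section

variable {d : ℕ}

theorem lexLT_iff_toColex_lt {u v : Site d} : LexLT u v ↔ toColex u < toColex v :=
  exists_congr fun _ => and_comm

instance : IsStrictTotalOrder (Site d) LexLT where
  trichotomous u v h1 h2 := by
    rw [lexLT_iff_toColex_lt] at h1 h2
    exact toColex.injective (le_antisymm (not_lt.1 h2) (not_lt.1 h1))
  irrefl u hu := lt_irrefl _ (lexLT_iff_toColex_lt.1 hu)
  trans u v w huv hvw := lexLT_iff_toColex_lt.2
    ((lexLT_iff_toColex_lt.1 huv).trans (lexLT_iff_toColex_lt.1 hvw))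

/-- A telescoping sum over a finite set, along a linear order. -/
theorem sum_sub_eq_of_isStrictTotalOrder {α : Type*} (r : α → α → Prop) [IsStrictTotalOrder α r]
    (F : Set α → ℝ) (Λ : Finset α) :
    ∑ v ∈ Λ, (F {u | u ∈ Λ ∧ r v u} - F {u | u ∈ Λ ∧ (u = v ∨ r v u)}) = F ∅ - F Λ := by
  classical
  let _ : LinearOrder α := linearOrderOfSTO r
  have hr : ∀ u v : α, r u v ↔ u < v := fun _ _ => Iff.rfl
  -- The new element lies below all others: its own term is `F Λ - F (insert a Λ)`, and the sets in
  -- the remaining terms do not see it.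
  induction Λ using Finset.induction_on_min with
  | empty => simp
  | insert a Λ ha ih =>
    have haΛ : a ∉ Λ := fun hm => lt_irrefl _ (ha a hm)
    rw [Finset.sum_insert haΛ]
    have h1 : {u | u ∈ insert a Λ ∧ r a u} = (Λ : Set α) := by
      ext u
      simp only [Set.mem_ofPred_eq, Finset.mem_insert, hr, Finset.mem_coe]
      constructor
      · rintro ⟨rfl | hu, hau⟩
        exacts [absurd hau (lt_irrefl _), hu]
      · exact fun hu => ⟨Or.inr hu, ha u hu⟩
    have h2 : {u | u ∈ insert a Λ ∧ (u = a ∨ r a u)} = ((insert a Λ : Finset α) : Set α) := by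
      ext u
      refine and_iff_left_of_imp fun hu => ?_
      rcases Finset.mem_insert.1 hu with rfl | hu
      exacts [Or.inl rfl, Or.inr (ha u hu)]
    have h3 : ∀ v ∈ Λ, ∀ u, r v u → (u ∈ insert a Λ ↔ u ∈ Λ) := by
      intro v hv u hvu
      rw [Finset.mem_insert]
      exact or_iff_right fun hua => lt_asymm (ha v hv) (hua ▸ hvu)
    have h4 : ∀ v ∈ Λ,
        F {u | u ∈ insert a Λ ∧ r v u} - F {u | u ∈ insert a Λ ∧ (u = v ∨ r v u)} =
        F {u | u ∈ Λ ∧ r v u} - F {u | u ∈ Λ ∧ (u = v ∨ r v u)} := by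
      intro v hv
      congr 2
      · ext u
        exact and_congr_left fun hu => h3 v hv u hu
      · ext u
        refine and_congr_left fun hu => ?_
        rcases hu with rfl | hu
        · exact iff_of_true (Finset.mem_insert_of_mem hv) hv
        · exact h3 v hv u hu
    rw [h1, h2, Finset.sum_congr rfl h4, ih]
    ring

/-- The translate of `Λ` that moves `v` to the origin. -/
def shift (Λ : Finset (Site d)) (v : Site d) : Finset (Site d) :=
  Λ.map (Equiv.subRight v).toEmbedding

theorem mem_shift {Λ : Finset (Site d)} {u v : Site d} : u ∈ shift Λ v ↔ u + v ∈ Λ := by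
  simp only [shift, Finset.mem_map_equiv]
  rfl

theorem adj_sub_right {u v w : Site d} : Adj (u - w) (v - w) ↔ Adj u v := by
  simp [Adj, l1]

theorem lexLT_sub_right {u v w : Site d} : LexLT (u - w) (v - w) ↔ LexLT u v := by
  simp [LexLT]

theorem eq_add_single_of_adj_of_lexLT {u v : Site d} (hadj : Adj u v) (hlt : LexLT u v) :
    ∃ j, v = u + Pi.single j 1 := by
  obtain ⟨k, hk, -⟩ := hlt
  refine ⟨k, ?_⟩
  unfold Adj l1 at hadj
  rw [← Finset.add_sum_erase _ _ (Finset.mem_univ k)] at hadj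
  have h0 : ∑ i ∈ Finset.univ.erase k, (u i - v i).natAbs = 0 := by omega
  rw [Finset.sum_eq_zero_iff] at h0
  funext i
  by_cases hi : i = k
  · subst hi
    simp only [Pi.add_apply, Pi.single_eq_same]
    omega
  · have := h0 i (Finset.mem_erase.2 ⟨hi, Finset.mem_univ i⟩)
    simp only [Pi.add_apply, Pi.single_eq_of_ne hi]
    omega

theorem adj_add_single (u : Site d) (j : Fin d) : Adj u (u + Pi.single j 1) := by
  unfold Adj l1
  rw [Finset.sum_eq_single j]
  · simp
  · intro i _ hi
    simp [hi]
  · simp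

theorem lexLT_add_single (u : Site d) (j : Fin d) : LexLT u (u + Pi.single j 1) :=
  ⟨j, by simp, fun i hi => by simp [hi.ne.symm]⟩

/-- The number of edges of the graph induced by `Λ`. -/
def edgeCount (Λ : Finset (Site d)) : ℕ := ∑ j, (Λ.filter fun v => v + Pi.single j 1 ∈ Λ).card

open scoped Classical in
theorem card_filter_adj_lexLT (Λ : Finset (Site d)) :
    ((Λ ×ˢ Λ).filter fun p => Adj p.1 p.2 ∧ LexLT p.1 p.2).card = edgeCount Λ := by
  rw [edgeCount, ← Finset.card_sigma]
  symm
  refine Finset.card_bij (fun q _ => (q.2, q.2 + Pi.single q.1 1)) ?_ ?_ ?_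
  · rintro ⟨j, v⟩ hq
    simp only [Finset.mem_sigma, Finset.mem_univ, true_and, Finset.mem_filter] at hq
    simp only [Finset.mem_filter, Finset.mem_product]
    exact ⟨hq, adj_add_single v j, lexLT_add_single v j⟩
  · rintro ⟨j, v⟩ - ⟨i, w⟩ - heq
    simp only [Prod.mk.injEq] at heq
    obtain ⟨rfl, h2⟩ := heq
    have h3 : (Pi.single j 1 : Site d) = Pi.single i 1 := add_left_cancel h2
    have : j = i := by
      by_contra hne
      have := congrFun h3 j
      simp [Pi.single_eq_of_ne hne] at this
    rw [this]
  · rintro ⟨u, v⟩ hp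
    simp only [Finset.mem_filter, Finset.mem_product] at hp
    obtain ⟨⟨hu, hv⟩, hadj, hlt⟩ := hp
    obtain ⟨j, rfl⟩ := eq_add_single_of_adj_of_lexLT hadj hlt
    exact ⟨⟨j, u⟩, by simp [hu, hv], rfl⟩

variable {χ : Type*} (H : χ → χ → WithTop ℝ) (h : χ → ℝ)

theorem globalWeight_const {s : χ} {x : ℝ} (hx : H s s = x) (Λ : Finset (Site d)) :
    globalWeight H h Λ (fun _ => s) = Real.exp (-(edgeCount Λ * x) - Λ.card * h s) := by
  classical
  unfold globalWeight pairFactor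
  rw [← Finset.prod_filter, Finset.prod_const, Finset.prod_const, hx, boltzmann_coe,
    card_filter_adj_lexLT, ← Real.exp_nat_mul, ← Real.exp_nat_mul, ← Real.exp_add]
  congr 1
  ring

theorem globalWeight_shift (Λ : Finset (Site d)) (v : Site d) (σ : Site d → χ) :
    globalWeight H h (shift Λ v) σ = globalWeight H h Λ fun u => σ (u - v) := by
  classical
  unfold globalWeight
  rw [Finset.prod_product, Finset.prod_product, shift, Finset.prod_map, Finset.prod_map]
  refine congrArg₂ _ (Finset.prod_congr rfl fun u _ => ?_) rfl
  rw [Finset.prod_map]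
  exact Finset.prod_congr rfl fun w _ =>
    if_congr (and_congr adj_sub_right lexLT_sub_right) rfl rfl

variable [Fintype χ]

theorem mass_agree_shift (Λ : Finset (Site d)) (v : Site d) (T : Set (Site d)) (s : χ) :
    mass H h (shift Λ v) (agree (shift Λ v) T fun _ => s) =
      mass H h Λ (agree Λ {u | u - v ∈ T} fun _ => s) := by
  classical
  rw [mass_agree, mass_agree, Finset.sum_filter, Finset.sum_filter]
  let e : shift Λ v ≃ Λ :=
    { toFun := fun u => ⟨u + v, mem_shift.1 u.2⟩
      invFun := fun u => ⟨u - v, mem_shift.2 (by rw [sub_add_cancel]; exact u.2)⟩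
      left_inv := fun u => by ext1; simp
      right_inv := fun u => by ext1; simp }
  refine Fintype.sum_equiv (e.arrowCongr (Equiv.refl χ)) _ _ fun σ => ?_
  have hw : weight H h (shift Λ v) σ = weight H h Λ (e.arrowCongr (Equiv.refl χ) σ) := by
    rw [weight_eq_globalWeight_extend H h _ fun _ => s, globalWeight_shift, ← weight_restrict]
    congr 1
    funext u
    exact extend_of_mem (D := (shift Λ v : Set (Site d))) (e.symm u).2
  refine if_congr ?_ hw rfl
  constructor
  · intro hσ u hu
    exact hσ (e.symm u) hu
  · intro hσ u hu
    have := hσ (e u) (by simpa [e] using hu)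
    simpa using this

/-- The probability that the spin at the origin is `s`, given that the later spins are `s`, in the
finite volume `Λ`. -/
def cavityProb (s : χ) (Λ : Finset (Site d)) : ℝ :=
  condProb H h Λ (agree (Λ : Set (Site d)) {0} fun _ => s)
    (agree (Λ : Set (Site d)) {u | LexLT 0 u} fun _ => s)

variable {H h}

theorem mass_agree_const_pos {s : χ} {x : ℝ} (hx : H s s = x) (Λ : Finset (Site d))
    (T : Set (Site d)) : 0 < mass H h Λ (agree Λ T fun _ => s) :=
  (by rw [globalWeight_const H h hx]; exact Real.exp_pos _ :
    0 < globalWeight H h Λ fun _ => s).trans_le (globalWeight_le_mass H h _)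

/-- In this form the cavity probabilities are quotients of successive terms of a telescoping
product. It needs the order and the weights to be translation invariant. -/
theorem cavityProb_shift (s : χ) (Λ : Finset (Site d)) (v : Site d) :
    cavityProb H h s (shift Λ v) = mass H h Λ (agree Λ {u | u = v ∨ LexLT v u} fun _ => s) /
      mass H h Λ (agree Λ {u | LexLT v u} fun _ => s) := by
  have h1 : agree (shift Λ v : Set (Site d)) {0} (fun _ => s) ∩
      agree (shift Λ v : Set (Site d)) {u | LexLT 0 u} (fun _ => s) =
      agree (shift Λ v : Set (Site d)) {u | u = 0 ∨ LexLT 0 u} fun _ => s := by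
    ext σ
    constructor
    · rintro ⟨h1, h2⟩ u (hu | hu)
      exacts [h1 u hu, h2 u hu]
    · exact fun hσ => ⟨fun u hu => hσ u (Or.inl hu), fun u hu => hσ u (Or.inr hu)⟩
  have h2 : ∀ u : Site d, LexLT 0 (u - v) ↔ LexLT v u := fun u => by
    rw [← lexLT_sub_right (u := v) (w := v), sub_self]
  rw [cavityProb, condProb, h1, mass_agree_shift, mass_agree_shift]
  simp only [Set.mem_ofPred_eq, h2, sub_eq_zero]

/-- Telescope the logarithm of the mass of configurations equal to `s` on `T`: for `T = ∅` the mass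
is `Z_Λ`, for `T = Λ` it is the weight of the constant configuration, and fixing `v` after all later
sites costs one cavity probability. -/
theorem log_partitionFn {s : χ} {x : ℝ} (hx : H s s = x) (Λ : Finset (Site d)) :
    Real.log (partitionFn H h Λ) = -(edgeCount Λ * x) - Λ.card * h s -
      ∑ v ∈ Λ, Real.log (cavityProb H h s (shift Λ v)) := by
  classical
  have key := sum_sub_eq_of_isStrictTotalOrder LexLT
    (fun T => Real.log (mass H h Λ (agree Λ T fun _ => s))) Λ
  have h0 : mass H h Λ (agree (Λ : Set (Site d)) ∅ fun _ => s) = partitionFn H h Λ := by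
    rw [mass_agree]
    simp [partitionFn]
  have hfil : ∀ p : Site d → Prop, agree (Λ : Set (Site d)) {u | u ∈ Λ ∧ p u} (fun _ => s) =
      agree (Λ : Set (Site d)) {u | p u} fun _ => s := by
    intro p
    ext σ
    exact ⟨fun hσ u hu => hσ u ⟨u.2, hu⟩, fun hσ u hu => hσ u hu.2⟩
  simp only [h0, mass_agree_self, globalWeight_const H h hx, Real.log_exp, hfil] at key
  have hterm : ∀ v ∈ Λ, Real.log (cavityProb H h s (shift Λ v)) =
      -(Real.log (mass H h Λ (agree Λ {u | LexLT v u} fun _ => s)) -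
        Real.log (mass H h Λ (agree Λ {u | u = v ∨ LexLT v u} fun _ => s))) := by
    intro v _
    rw [cavityProb_shift, Real.log_div (mass_agree_const_pos hx _ _).ne'
      (mass_agree_const_pos hx _ _).ne']
    ring
  rw [Finset.sum_congr rfl hterm, Finset.sum_neg_distrib, key]
  ring

end

/-! ### Cavity marginals: existence, bounds and comparison -/

theorem abs_log_sub_log_le {a b c : ℝ} (hc : 0 < c) (ha : c ≤ a) (hb : c ≤ b) :
    |Real.log a - Real.log b| ≤ |a - b| / c := by
  have key : ∀ a b : ℝ, c ≤ a → c ≤ b → Real.log a - Real.log b ≤ |a - b| / c := by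
    intro a b ha hb
    have ha' := hc.trans_le ha
    have hb' := hc.trans_le hb
    rw [← Real.log_div ha'.ne' hb'.ne']
    calc Real.log (a / b) ≤ a / b - 1 := Real.log_le_sub_one_of_pos (div_pos ha' hb')
      _ = (a - b) / b := by field_simp
      _ ≤ |a - b| / b := div_le_div_of_nonneg_right (le_abs_self _) hb'.le
      _ ≤ |a - b| / c := div_le_div_of_nonneg_left (abs_nonneg _) hc hb
  rw [abs_le]
  have h1 := key a b ha hb
  have h2 := key b a hb ha
  rw [abs_sub_comm] at h2
  exact ⟨by linarith, h1⟩

section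

variable {d : ℕ} {χ : Type*} {H : χ → χ → WithTop ℝ} {h : χ → ℝ} [Fintype χ]
  [MeasurableSpace χ] {s : χ}

theorem IsCavityMarginal.le_one {D : Set (Site d)} {p : ℝ} (hp : IsCavityMarginal H h D s p) :
    p ≤ 1 := by
  obtain ⟨μ, hμ, rfl⟩ := hp
  have := ((hμ μ).2 rfl).prob
  exact measureReal_le_one

variable [MeasurableSingletonClass χ]

theorem isGibbs_cavity {x : ℝ} (hx : H s s = x) (Λ : Finset (Site d)) :
    IsGibbs H h (Λ : Set (Site d)) {u | LexLT 0 u} (fun _ => s)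
      (finiteGibbs H h Λ {u | LexLT 0 u} fun _ => s) :=
  isGibbs_finiteGibbs H h (mass_agree_const_pos hx _ _).ne'

theorem cavityProb_eq_real (Λ : Finset (Site d)) :
    cavityProb H h s Λ = (finiteGibbs H h Λ {u | LexLT 0 u} fun _ => s).real
      (agree (Λ : Set (Site d)) {0} fun _ => s) :=
  (finiteGibbs_real H h Λ _ _ _).symm

/-- This comparison has no rate but needs only uniqueness on `D`; it covers half-spaces at a fixed
depth, where the distance to the boundary stays bounded. -/
theorem exists_abs_cavityProb_sub_lt {D : Set (Site d)} (hD : 0 ∈ D) {p : ℝ}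
    (hp : IsCavityMarginal H h D s p) {x : ℝ} (hx : H s s = x) {ε : ℝ} (hε : 0 < ε) :
    ∃ M : ℕ, ∀ Λ : Finset (Site d), (∀ u, l1 u 0 ≤ M → (u ∈ Λ ↔ u ∈ D)) →
      |cavityProb H h s Λ - p| < ε := by
  obtain ⟨μ, hμ, rfl⟩ := hp
  obtain ⟨M, hM⟩ := exists_abs_real_sub_lt (fun ν hν => (hμ ν).1 hν) (X := {0}) (by simpa using hD)
    (fun _ => s) hε
  refine ⟨M, fun Λ hΛ => ?_⟩
  have := hM Λ hΛ _ (isGibbs_cavity hx Λ)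
  rw [cavityProb_eq_real]
  simpa only [Finset.coe_singleton] using this

/-- Under strong spatial mixing, the cavity marginal on `ℤ^d` is well defined. -/
theorem exists_isCavityMarginal_univ {x : ℝ} (hx : H s s = x) (hSSM : SSM d H h) :
    ∃ p, IsCavityMarginal H h (Set.univ : Set (Site d)) s p := by
  obtain ⟨μ, hμ, -⟩ := exists_isGibbs_limit (D := Set.univ)
    (fun m => isGibbs_cavity (H := H) (h := h) hx (ball {(0 : Site d)} m))
    (fun m u hu => iff_of_true (Finset.mem_coe.2 (mem_ball.2 ⟨0, by simp, hu⟩)) (Set.mem_univ u))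
  exact ⟨_, μ, fun ν => ⟨fun hν => hν.eq_of_ssm hSSM hμ, fun hν => hν ▸ hμ⟩, rfl⟩

theorem exists_pos_le_cavity (hsymm : ∀ s t, H s t = H t s) (hs : ∀ t, H t s ≠ ⊤)
    {x : ℝ} (hx : H s s = x) :
    ∃ c > 0, (∀ D : Set (Site d), 0 ∈ D → ∀ p, IsCavityMarginal H h D s p → c ≤ p) ∧
      ∀ Λ : Finset (Site d), 0 ∈ Λ → c ≤ cavityProb H h s Λ := by
  obtain ⟨c, hc, hcD⟩ := exists_pos_le_real_agree (h := h) hsymm hs (Y := {u : Site d | LexLT 0 u})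
    (irrefl (r := LexLT) (0 : Site d)) fun _ => s
  refine ⟨c, hc, ?_, fun Λ hΛ => ?_⟩
  · rintro D hD p ⟨μ, hμ, rfl⟩
    exact hcD D hD μ ((hμ μ).2 rfl)
  · rw [cavityProb_eq_real]
    exact hcD Λ hΛ _ (isGibbs_cavity hx Λ)

theorem cavityProb_le_one {x : ℝ} (hx : H s s = x) (Λ : Finset (Site d)) :
    cavityProb H h s Λ ≤ 1 := by
  rw [cavityProb_eq_real]
  have := (isGibbs_cavity (h := h) hx Λ).prob
  exact measureReal_le_one

/-- The rate depends only on a ball contained in both graphs. For the whole lattice and a half-space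
at depth `k` this gives `R k`, whence the convergence of the series. -/
theorem IsCavityMarginal.abs_sub_le {D D' : Set (Site d)} {p p' : ℝ}
    (hp : IsCavityMarginal H h D s p) (hp' : IsCavityMarginal H h D' s p') {R : ℕ → ℝ}
    (hR : IsSSMRate H h {(0 : Site d)} {u | LexLT 0 u} R) {r : ℕ} (hr : 1 ≤ r)
    (hD : (ball {(0 : Site d)} r : Set (Site d)) ⊆ D)
    (hD' : (ball {(0 : Site d)} r : Set (Site d)) ⊆ D') :
    |p - p'| ≤ R r := by
  obtain ⟨μ, hμ, rfl⟩ := hp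
  obtain ⟨μ', hμ', rfl⟩ := hp'
  have := ((hμ μ).2 rfl).abs_real_sub_le ((hμ' μ').2 rfl) hR hr hD hD' fun _ => s
  simpa only [Finset.coe_singleton] using this

theorem IsCavityMarginal.abs_cavityProb_sub_le {D : Set (Site d)} {p : ℝ}
    (hp : IsCavityMarginal H h D s p) {x : ℝ} (hx : H s s = x) {R : ℕ → ℝ}
    (hR : IsSSMRate H h {(0 : Site d)} {u | LexLT 0 u} R) {r : ℕ} (hr : 1 ≤ r)
    (hD : (ball {(0 : Site d)} r : Set (Site d)) ⊆ D) {Λ : Finset (Site d)} (hΛ : ball {0} r ⊆ Λ) :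
    |cavityProb H h s Λ - p| ≤ R r := by
  obtain ⟨μ, hμ, rfl⟩ := hp
  have := (isGibbs_cavity hx Λ).abs_real_sub_le ((hμ μ).2 rfl) hR hr hΛ hD fun _ => s
  rw [cavityProb_eq_real]
  simpa only [Finset.coe_singleton] using this

end

/-! ### The free energy -/

section

variable {d : ℕ}

theorem card_ball_le (X : Finset (Site d)) (r : ℕ) :
    (ball X r).card ≤ X.card * (2 * r + 1) ^ d := by
  refine Finset.card_biUnion_le_card_mul _ _ _ fun v _ => (Finset.card_filter_le _ _).trans ?_
  rw [Pi.card_Icc]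
  refine (Finset.prod_le_prod' (g := fun _ => 2 * r + 1) fun i _ => ?_).trans_eq (by simp)
  rw [Int.card_Icc]
  omega

theorem exists_adj_l1_lt {u v : Site d} (huv : u ≠ v) :
    ∃ w, Adj v w ∧ l1 w u + 1 ≤ l1 v u := by
  obtain ⟨i, hi⟩ := Function.ne_iff.1 huv
  have key : ∀ ε : ℤ, ε.natAbs = 1 → (v i + ε - u i).natAbs + 1 = (v i - u i).natAbs →
      ∃ w, Adj v w ∧ l1 w u + 1 ≤ l1 v u := by
    intro ε hε hlt
    refine ⟨Function.update v i (v i + ε), ?_, ?_⟩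
    · unfold Adj l1
      rw [Finset.sum_eq_single i]
      · simpa using hε
      · intro j _ hj
        simp [hj]
      · simp
    · unfold l1
      rw [← Finset.add_sum_erase _ _ (Finset.mem_univ i),
        ← Finset.add_sum_erase _ (fun j => (v j - u j).natAbs) (Finset.mem_univ i),
        Function.update_self, Finset.sum_congr rfl fun j hj => by
          rw [Function.update_of_ne (Finset.ne_of_mem_erase hj)]]
      omega
  rcases lt_or_gt_of_ne hi with hlt | hlt
  · exact key (-1) (by simp) (by omega)
  · exact key 1 (by simp) (by omega)

/-- A shortest walk from `v` to `u` leaves `A`, and its last site before that is a boundary site.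
Thus sites whose `M`-ball is not contained in `Λ` are within `M` of the boundary. -/
theorem exists_mem_bdry_l1_le {A : Set (Site d)} {v u : Site d} (hv : v ∈ A) (hu : u ∉ A) :
    ∃ w ∈ bdry Set.univ A, l1 v w ≤ l1 v u := by
  induction hn : l1 v u using Nat.strong_induction_on generalizing v with
  | _ n ih =>
    have hne : u ≠ v := fun he => hu (he ▸ hv)
    obtain ⟨w, hadj, hlt⟩ := exists_adj_l1_lt hne
    by_cases hw : w ∈ A
    · obtain ⟨z, hz, hle⟩ := ih (l1 w u) (by omega) hw rfl
      refine ⟨z, hz, ?_⟩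
      have := l1_triangle v w z
      have h1 : l1 v w = 1 := hadj
      omega
    · exact ⟨v, ⟨hv, w, Set.mem_univ w, hadj, hw⟩, by simp [l1]⟩

theorem edgeCount_add_sum_card (Λ : Finset (Site d)) :
    (edgeCount Λ : ℝ) + ∑ j, ((Λ.filter fun v => v + Pi.single j 1 ∉ Λ).card : ℝ) =
      d * Λ.card := by
  unfold edgeCount
  push_cast
  rw [← Finset.sum_add_distrib]
  have : ∀ j : Fin d, ((Λ.filter fun v => v + Pi.single j 1 ∈ Λ).card : ℝ) +
      (Λ.filter fun v => v + Pi.single j 1 ∉ Λ).card = Λ.card := fun j => by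
    rw [← Nat.cast_add, Finset.card_filter_add_card_filter_not]
  rw [Finset.sum_congr rfl fun j _ => this j]
  simp

variable {χ : Type*} {H : χ → χ → WithTop ℝ} {h : χ → ℝ} [Fintype χ]
  [MeasurableSpace χ] [MeasurableSingletonClass χ] {s : χ}

theorem zero_mem_shift {Λ : Finset (Site d)} {v : Site d} : 0 ∈ shift Λ v ↔ v ∈ Λ := by
  rw [mem_shift, zero_add]

theorem exists_abs_log_partitionFn_sub_le (hsymm : ∀ s t, H s t = H t s) (hs : ∀ t, H t s ≠ ⊤)
    {x : ℝ} (hx : H s s = x) {p : ℝ} (hp : IsCavityMarginal H h (Set.univ : Set (Site d)) s p)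
    {ε : ℝ} (hε : 0 < ε) :
    ∃ K : ℝ, ∀ Λ : Finset (Site d),
      |Real.log (partitionFn H h Λ) - Λ.card * (-Real.log p - d * x - h s)| ≤
        ε * Λ.card + K * (bdry Set.univ (Λ : Set (Site d))).ncard := by
  classical
  obtain ⟨c, hc, hcD, hcΛ⟩ := exists_pos_le_cavity (d := d) (h := h) hsymm hs hx
  have hcp : c ≤ p := hcD _ (Set.mem_univ _) p hp
  -- The logarithm has Lipschitz constant `1 / c` on `[c, ∞)`, so closeness `ε * c` of the
  -- probabilities gives `ε` for their logarithms.
  obtain ⟨M, hM⟩ := exists_abs_cavityProb_sub_lt (Set.mem_univ _) hp hx (mul_pos hε hc)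
  -- The first summand pays for the missing edges, at most `d` per boundary site. The second pays
  -- for the sites within `M` of the boundary, where the logarithms differ by at most `1 / c`.
  refine ⟨d * |x| + (2 * M + 1) ^ d * (1 / c), fun Λ => ?_⟩
  set B : Finset (Site d) := Λ.filter (· ∈ bdry Set.univ (Λ : Set (Site d))) with hB
  have hBbdry : (B : Set (Site d)) = bdry Set.univ (Λ : Set (Site d)) := by
    ext v
    rw [hB, Finset.coe_filter]
    exact ⟨fun hv => hv.2, fun hv => ⟨hv.1, hv⟩⟩
  rw [← hBbdry, Set.ncard_coe_finset, log_partitionFn hx]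
  have hedge := edgeCount_add_sum_card Λ
  set E := ∑ j : Fin d, ((Λ.filter fun v => v + Pi.single j 1 ∉ Λ).card : ℝ) with hE
  have hE0 : 0 ≤ E := Finset.sum_nonneg fun _ _ => Nat.cast_nonneg _
  have hEB : E ≤ d * B.card := by
    refine (Finset.sum_le_sum (g := fun _ => (B.card : ℝ)) fun j _ => ?_).trans_eq (by simp)
    refine Nat.cast_le.2 (Finset.card_le_card fun v hv => ?_)
    rw [Finset.mem_filter] at hv
    exact Finset.mem_filter.2 ⟨hv.1, hv.1, _, Set.mem_univ _, adj_add_single v j, hv.2⟩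
  have hterm : ∀ v ∈ Λ, |Real.log p - Real.log (cavityProb H h s (shift Λ v))| ≤
      ε + if v ∈ ball B M then 1 / c else 0 := by
    intro v hv
    have hq := hcΛ (shift Λ v) (zero_mem_shift.2 hv)
    refine (abs_log_sub_log_le hc hcp hq).trans ?_
    split_ifs with hvB
    · have h1 : |p - cavityProb H h s (shift Λ v)| ≤ 1 := by
        rw [abs_le]
        constructor <;> linarith [hp.le_one, cavityProb_le_one (h := h) hx (shift Λ v)]
      have := div_le_div_of_nonneg_right h1 hc.le
      linarith
    · rw [add_zero, div_le_iff₀ hc, abs_sub_comm]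
      refine (hM _ fun u hu => iff_of_true ?_ (Set.mem_univ u)).le
      rw [mem_shift]
      by_contra hn
      obtain ⟨w, hw, hle⟩ := exists_mem_bdry_l1_le (A := (Λ : Set (Site d))) hv hn
      rw [← hBbdry] at hw
      refine hvB (mem_ball.2 ⟨w, hw, hle.trans ?_⟩)
      rw [l1_comm]
      refine le_trans (le_of_eq ?_) hu
      simp [l1]
  have hsum : |Λ.card * Real.log p - ∑ v ∈ Λ, Real.log (cavityProb H h s (shift Λ v))| ≤
      ε * Λ.card + B.card * (2 * M + 1) ^ d * (1 / c) := by
    rw [← nsmul_eq_mul, ← Finset.sum_const, ← Finset.sum_sub_distrib]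
    refine (Finset.abs_sum_le_sum_abs _ _).trans ((Finset.sum_le_sum hterm).trans ?_)
    rw [Finset.sum_add_distrib, Finset.sum_const, nsmul_eq_mul, mul_comm, ← Finset.sum_filter,
      Finset.sum_const, nsmul_eq_mul]
    gcongr
    refine le_trans (Nat.cast_le.2 ((Finset.card_le_card ?_).trans (card_ball_le B M))) (by simp)
    exact fun v hv => (Finset.mem_filter.1 hv).2
  have hEx : |E * x| ≤ d * B.card * |x| := by
    rw [abs_mul, abs_of_nonneg hE0]
    gcongr
  have : -(edgeCount Λ * x) - Λ.card * h s - ∑ v ∈ Λ, Real.log (cavityProb H h s (shift Λ v)) -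
      Λ.card * (-Real.log p - d * x - h s) =
      E * x + (Λ.card * Real.log p - ∑ v ∈ Λ, Real.log (cavityProb H h s (shift Λ v))) := by
    rw [show (edgeCount Λ : ℝ) = d * Λ.card - E by linarith]
    ring
  rw [this]
  refine (abs_add_le _ _).trans ((add_le_add hEx hsum).trans (le_of_eq ?_))
  ring

theorem isFreeEnergy_of_isCavityMarginal (hsymm : ∀ s t, H s t = H t s) (hs : ∀ t, H t s ≠ ⊤)
    {x : ℝ} (hx : H s s = x) {p : ℝ} (hp : IsCavityMarginal H h (Set.univ : Set (Site d)) s p) :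
    IsFreeEnergy d H h (-Real.log p - d * x - h s) := by
  intro Λ hne hbd
  rw [Metric.tendsto_atTop']
  intro ε hε
  obtain ⟨K, hK⟩ := exists_abs_log_partitionFn_sub_le (h := h) hsymm hs hx hp (half_pos hε)
  have h1 := (hbd.const_mul K).eventually (gt_mem_nhds (by simpa using half_pos hε : K * 0 < ε / 2))
  obtain ⟨N, hN⟩ := eventually_atTop.1 h1
  refine ⟨N, fun n hn => ?_⟩
  have hcard : (0 : ℝ) < (Λ n).card := Nat.cast_pos.2 (Finset.card_pos.2 (hne n))
  have h2 := hN n hn.le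
  rw [Real.dist_eq, div_sub' hcard.ne', abs_div, abs_of_pos hcard, div_lt_iff₀ hcard]
  refine (hK (Λ n)).trans_lt ?_
  rw [← mul_div_assoc, div_lt_iff₀ hcard] at h2
  linarith

end

/-! ### Counting sites of a box by their distance to the faces -/

section

variable {d : ℕ}

/-- The box `∏_j [-N_j, N_j]`. -/
def symBox (N : Fin d → ℕ) : Finset (Site d) :=
  Finset.Icc (fun j => -(N j : ℤ)) (fun j => (N j : ℤ))

/-- The number of sites of a face of `symBox N` orthogonal to the `j`-th axis. -/
def faceCard (N : Fin d → ℕ) (j : Fin d) : ℕ := ∏ i ∈ Finset.univ.erase j, (2 * N i + 1)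

/-- The distance of `v` to the face `α` of `symBox N`: the upper one in the direction `j` for
`α = (j, true)`, the lower one for `α = (j, false)`. -/
def faceDist (N : Fin d → ℕ) (v : Site d) (α : Fin d × Bool) : ℕ :=
  if α.2 then (N α.1 - v α.1).toNat else (N α.1 + v α.1).toNat

theorem mem_symBox {N : Fin d → ℕ} {v : Site d} :
    v ∈ symBox N ↔ ∀ j, -(N j : ℤ) ≤ v j ∧ v j ≤ N j := by
  simp only [symBox, Finset.mem_Icc, Pi.le_def, forall_and]

theorem symBox_eq_piFinset (N : Fin d → ℕ) :
    symBox N = Fintype.piFinset fun j => Finset.Icc (-(N j : ℤ)) (N j) := by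
  ext v
  simp [mem_symBox]

theorem card_Icc_neg (n : ℕ) : (Finset.Icc (-(n : ℤ)) n).card = 2 * n + 1 := by
  rw [Int.card_Icc]
  omega

theorem sum_Icc_toNat_sub (n : ℕ) (φ : ℕ → ℝ) :
    ∑ t ∈ Finset.Icc (-(n : ℤ)) n, φ (n - t).toNat = ∑ k ∈ Finset.range (2 * n + 1), φ k := by
  refine Finset.sum_nbij' (fun t => (n - t).toNat) (fun k => (n : ℤ) - k) ?_ ?_ ?_ ?_ ?_
  · intro t ht
    rw [Finset.mem_Icc] at ht
    rw [Finset.mem_range]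
    omega
  · intro k hk
    rw [Finset.mem_range] at hk
    rw [Finset.mem_Icc]
    omega
  · intro t ht
    rw [Finset.mem_Icc] at ht
    omega
  · intro k _
    omega
  · exact fun _ _ => rfl

theorem sum_Icc_toNat_add (n : ℕ) (φ : ℕ → ℝ) :
    ∑ t ∈ Finset.Icc (-(n : ℤ)) n, φ (n + t).toNat = ∑ k ∈ Finset.range (2 * n + 1), φ k := by
  refine Finset.sum_nbij' (fun t => (n + t).toNat) (fun k => (k : ℤ) - n) ?_ ?_ ?_ ?_ ?_
  · intro t ht
    rw [Finset.mem_Icc] at ht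
    rw [Finset.mem_range]
    omega
  · intro k hk
    rw [Finset.mem_range] at hk
    rw [Finset.mem_Icc]
    omega
  · intro t ht
    rw [Finset.mem_Icc] at ht
    omega
  · intro k _
    omega
  · exact fun _ _ => rfl

theorem sum_symBox_apply (N : Fin d → ℕ) (j : Fin d) (φ : ℤ → ℝ) :
    ∑ v ∈ symBox N, φ (v j) = faceCard N j * ∑ t ∈ Finset.Icc (-(N j : ℤ)) (N j), φ t := by
  -- As a product over coordinates, the summand lets the sum over the box factor.
  have h1 : ∀ v : Site d, φ (v j) = ∏ i, if i = j then φ (v i) else 1 := fun v => by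
    rw [Finset.prod_ite_eq' Finset.univ j fun i => φ (v i)]
    simp
  rw [Finset.sum_congr rfl fun v _ => h1 v, symBox_eq_piFinset,
    ← Finset.prod_univ_sum (fun i => Finset.Icc (-(N i : ℤ)) (N i))
      fun i t => if i = j then φ t else 1, ← Finset.mul_prod_erase _ _ (Finset.mem_univ j),
    mul_comm]
  congr 1
  · rw [faceCard, Nat.cast_prod]
    refine Finset.prod_congr rfl fun i hi => ?_
    simp only [Finset.ne_of_mem_erase hi, if_false, Finset.sum_const, card_Icc_neg, nsmul_eq_mul,
      mul_one]
  · simp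

theorem sum_symBox_faceDist (N : Fin d → ℕ) (α : Fin d × Bool) (φ : ℕ → ℝ) :
    ∑ v ∈ symBox N, φ (faceDist N v α) =
      faceCard N α.1 * ∑ k ∈ Finset.range (2 * N α.1 + 1), φ k := by
  obtain ⟨j, _ | _⟩ := α
  · rw [← sum_Icc_toNat_add, ← sum_symBox_apply N j fun t => φ (N j + t).toNat]
    rfl
  · rw [← sum_Icc_toNat_sub, ← sum_symBox_apply N j fun t => φ (N j - t).toNat]
    rfl

theorem card_filter_faceDist_lt (N : Fin d → ℕ) (α : Fin d × Bool) (M : ℕ) :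
    ((Finset.Icc (-(N α.1 : ℤ)) (N α.1)).filter fun t : ℤ =>
      (if α.2 then (N α.1 - t).toNat else (N α.1 + t).toNat) < M).card ≤ M := by
  obtain ⟨j, _ | _⟩ := α
  · refine (Finset.card_le_card (t := Finset.Ico (-(N j : ℤ)) (-(N j : ℤ) + M)) ?_).trans ?_
    · intro t ht
      simp only [Finset.mem_filter, Finset.mem_Icc, Bool.false_eq_true, if_false] at ht
      rw [Finset.mem_Ico]
      omega
    · simp
  · refine (Finset.card_le_card (t := Finset.Ioc ((N j : ℤ) - M) (N j)) ?_).trans ?_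
    · intro t ht
      simp only [Finset.mem_filter, Finset.mem_Icc, if_true] at ht
      rw [Finset.mem_Ioc]
      omega
    · simp

/-- The sites of `symBox N` near both faces `α` and `β`. -/
def corner (N : Fin d → ℕ) (M : ℕ) (α β : Fin d × Bool) : Finset (Site d) :=
  (symBox N).filter fun v => faceDist N v α < M ∧ faceDist N v β < M

/-- Opposite faces are too far apart for a site to be near both. For faces on different axes two
coordinates have at most `M` values each, which saves a factor `2 * N β.1 + 1` against a full face.
-/
theorem card_corner_mul_le {N : Fin d → ℕ} {M : ℕ} (hN : ∀ j, M ≤ N j) {α β : Fin d × Bool}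
    (hαβ : α ≠ β) :
    (corner N M α β).card * (2 * N β.1 + 1) ≤ M ^ 2 * faceCard N α.1 := by
  by_cases hij : α.1 = β.1
  · have : corner N M α β = ∅ := by
      rw [corner, Finset.filter_eq_empty_iff]
      rintro v hv ⟨h1, h2⟩
      have hb : α.2 ≠ β.2 := fun hb => hαβ (Prod.ext hij hb)
      obtain ⟨i, a⟩ := α
      obtain ⟨j, b⟩ := β
      obtain rfl : i = j := hij
      have hv := mem_symBox.1 hv i
      have := hN i
      cases a <;> cases b <;> simp [faceDist] at h1 h2 hb <;> omega
    simp [this]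
  · let P (γ : Fin d × Bool) (t : ℤ) : Prop :=
      (if γ.2 then (N γ.1 - t).toNat else (N γ.1 + t).toNat) < M
    let T (l : Fin d) : Finset ℤ := (Finset.Icc (-(N l : ℤ)) (N l)).filter fun t =>
      (l = α.1 → P α t) ∧ (l = β.1 → P β t)
    have hsub : corner N M α β ⊆ Fintype.piFinset T := by
      intro v hv
      rw [corner, Finset.mem_filter] at hv
      rw [Fintype.mem_piFinset]
      intro l
      refine Finset.mem_filter.2 ⟨Finset.mem_Icc.2 (mem_symBox.1 hv.1 l), ?_, ?_⟩
      · rintro rfl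
        exact hv.2.1
      · rintro rfl
        exact hv.2.2
    have hmem : β.1 ∈ Finset.univ.erase α.1 :=
      Finset.mem_erase.2 ⟨fun he => hij he.symm, Finset.mem_univ _⟩
    have hT : ∀ γ : Fin d × Bool, ((Finset.Icc (-(N γ.1 : ℤ)) (N γ.1)).filter (P γ)).card ≤ M :=
      fun γ => card_filter_faceDist_lt N γ M
    have hα : (T α.1).card ≤ M := (Finset.card_le_card fun t ht => by
      rw [Finset.mem_filter] at ht ⊢
      exact ⟨ht.1, ht.2.1 rfl⟩).trans (hT α)
    have hβ : (T β.1).card ≤ M := (Finset.card_le_card fun t ht => by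
      rw [Finset.mem_filter] at ht ⊢
      exact ⟨ht.1, ht.2.2 rfl⟩).trans (hT β)
    have hcard : (corner N M α β).card ≤
        M * (M * ∏ l ∈ (Finset.univ.erase α.1).erase β.1, (2 * N l + 1)) := by
      refine (Finset.card_le_card hsub).trans ?_
      rw [Fintype.card_piFinset, ← Finset.mul_prod_erase _ _ (Finset.mem_univ α.1),
        ← Finset.mul_prod_erase _ _ hmem]
      exact Nat.mul_le_mul hα (Nat.mul_le_mul hβ (Finset.prod_le_prod' fun l _ =>
        (Finset.card_filter_le _ _).trans (card_Icc_neg _).le))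
    calc (corner N M α β).card * (2 * N β.1 + 1)
        ≤ M * (M * ∏ l ∈ (Finset.univ.erase α.1).erase β.1, (2 * N l + 1)) * (2 * N β.1 + 1) :=
          Nat.mul_le_mul_right _ hcard
      _ = M ^ 2 * faceCard N α.1 := by
          rw [faceCard, ← Finset.mul_prod_erase _ _ hmem]
          ring

theorem card_filter_add_single_notMem (N : Fin d → ℕ) (j : Fin d) :
    ((symBox N).filter fun v => v + Pi.single j 1 ∉ symBox N).card = faceCard N j := by
  have h1 : (symBox N).filter (fun v => v + Pi.single j 1 ∉ symBox N) =
      (symBox N).filter fun v => faceDist N v (j, true) = 0 := by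
    refine Finset.filter_congr fun v hv => ?_
    rw [mem_symBox] at hv
    constructor
    · intro hn
      by_contra h0
      refine hn (mem_symBox.2 fun i => ?_)
      by_cases hi : i = j
      · subst hi
        have := hv i
        simp only [faceDist, if_true] at h0
        simp only [Pi.add_apply, Pi.single_eq_same]
        omega
      · simpa [hi] using hv i
    · intro h0 hn
      have h1 := (mem_symBox.1 hn j).2
      simp only [faceDist, if_true] at h0
      simp only [Pi.add_apply, Pi.single_eq_same] at h1
      omega
  have h2 := sum_symBox_faceDist N (j, true) fun k => if k = 0 then 1 else 0
  rw [← Finset.sum_filter, Finset.sum_ite_eq' (Finset.range _) 0] at h2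
  rw [h1]
  simpa using h2

theorem box_eq_symBox {a : Fin d → ℝ} (ha : ∀ j, 0 < a j) (n : ℕ) :
    box a n = symBox fun j => ⌊a j * n⌋₊ := by
  unfold box symBox
  have : ∀ j, ⌊a j * n⌋ = ((⌊a j * n⌋₊ : ℕ) : ℤ) := fun j =>
    (Int.natCast_floor_eq_floor (mul_nonneg (ha j).le (Nat.cast_nonneg n))).symm
  simp only [this]

end

/-! ### Sums over boxes to surface order -/

section

variable {d : ℕ}

/-- A function on boxes that decays with the distance to the boundary, and that is close to `ψ α`
near the face `α`, is approximated by the sum of the `ψ α`, except near the corners. -/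
theorem exists_abs_sub_sum_faces_le (hd : 1 ≤ d) {f : (Fin d → ℕ) → Site d → ℝ}
    {ψ : Fin d × Bool → ℕ → ℝ} {C θ : ℝ} (hC : 0 ≤ C) (hθ0 : 0 < θ) (hθ1 : θ < 1)
    (hf : ∀ N, ∀ v ∈ symBox N, ∀ m, (∀ α, m ≤ faceDist N v α) → |f N v| ≤ C * θ ^ (2 * m))
    (hψ : ∀ α k, |ψ α k| ≤ C * θ ^ (2 * k))
    (hfψ : ∀ α k, ∀ ε > 0, ∃ M, ∀ N, ∀ v ∈ symBox N, faceDist N v α = k →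
      (∀ β, β ≠ α → M ≤ faceDist N v β) → |f N v - ψ α k| ≤ ε)
    {ε : ℝ} (hε : 0 < ε) :
    ∃ M : ℕ, ∃ C' : ℝ, 0 ≤ C' ∧ ∀ N, ∀ v ∈ symBox N, |f N v - ∑ α, ψ α (faceDist N v α)| ≤
      ε * ∑ α, θ ^ faceDist N v α +
        C' * ∑ α, ∑ β ∈ Finset.univ.erase α, if v ∈ corner N M α β then 1 else 0 := by
  have hpow : ∀ {m n : ℕ}, m ≤ n → θ ^ n ≤ θ ^ m := fun hmn =>
    pow_le_pow_of_le_one hθ0.le hθ1.le hmn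
  set C' : ℝ := C + Fintype.card (Fin d × Bool) * C with hC'
  have hC0 : 0 ≤ C' := by positivity
  have hlim : Tendsto (fun n : ℕ => C' * θ ^ n) atTop (𝓝 0) := by
    simpa using (tendsto_pow_atTop_nhds_zero_of_lt_one hθ0.le hθ1).const_mul C'
  -- Beyond depth `K`, half of the decay `θ ^ (2 * k)` absorbs the constant and leaves `ε * θ ^ k`,
  -- which is still summable in the depth.
  obtain ⟨K, hK⟩ := (hlim.eventually (gt_mem_nhds hε)).exists
  -- At depth below `K` the allowed error is at least `ε * θ ^ K`. One half is for the face
  -- approximation at the nearest face, the other for `ψ` at all remaining faces.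
  set δ : ℝ := ε * θ ^ K / 2 with hδ
  have hδ0 : 0 < δ := by positivity
  obtain ⟨M₁, hM₁⟩ := (hlim.eventually (gt_mem_nhds hδ0)).exists
  choose M₂ hM₂ using fun α k => hfψ α k δ hδ0
  set M : ℕ := max M₁ ((Finset.univ ×ˢ Finset.range K).sup fun q => M₂ q.1 q.2) with hM
  refine ⟨M, C', hC0, fun N v hv => ?_⟩
  have : Nonempty (Fin d × Bool) := ⟨(⟨0, hd⟩, true)⟩
  obtain ⟨α, hα⟩ := Finite.exists_min (faceDist N v)
  set k := faceDist N v α with hk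
  have hcorner : ∀ α β, (0 : ℝ) ≤ if v ∈ corner N M α β then 1 else 0 := fun α β => by
    split_ifs <;> norm_num
  have hcorner' : ∀ α, (0 : ℝ) ≤
      ∑ β ∈ Finset.univ.erase α, if v ∈ corner N M α β then 1 else 0 :=
    fun α => Finset.sum_nonneg fun β _ => hcorner α β
  have hθsum : θ ^ k ≤ ∑ β, θ ^ faceDist N v β :=
    Finset.single_le_sum (f := fun β => θ ^ faceDist N v β) (fun β _ => by positivity)
      (Finset.mem_univ α)
  have hψk : ∀ β, |ψ β (faceDist N v β)| ≤ C * θ ^ (2 * k) := fun β =>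
    (hψ β _).trans (mul_le_mul_of_nonneg_left (hpow (by have := hα β; omega)) hC)
  have hrough : |f N v - ∑ β, ψ β (faceDist N v β)| ≤ C' * θ ^ (2 * k) := by
    have h1 : |∑ β, ψ β (faceDist N v β)| ≤ Fintype.card (Fin d × Bool) * (C * θ ^ (2 * k)) := by
      refine (Finset.abs_sum_le_sum_abs _ _).trans ((Finset.sum_le_sum fun β _ => hψk β).trans ?_)
      rw [Finset.sum_const, nsmul_eq_mul, Finset.card_univ]
    have h2 := hf N v hv k hα
    calc |f N v - ∑ β, ψ β (faceDist N v β)| ≤ _ := abs_sub _ _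
      _ ≤ C * θ ^ (2 * k) + Fintype.card (Fin d × Bool) * (C * θ ^ (2 * k)) := add_le_add h2 h1
      _ = C' * θ ^ (2 * k) := by rw [hC']; ring
  by_cases hkK : K ≤ k
  · have h1 : C' * θ ^ (2 * k) ≤ ε * θ ^ k := by
      rw [two_mul, pow_add, ← mul_assoc]
      refine mul_le_mul_of_nonneg_right ?_ (by positivity)
      exact (mul_le_mul_of_nonneg_left (hpow hkK) hC0).trans hK.le
    have h2 := mul_le_mul_of_nonneg_left hθsum hε.le
    have h3 := mul_nonneg hC0 (Finset.sum_nonneg fun α (_ : α ∈ Finset.univ) => hcorner' α)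
    linarith
  · push Not at hkK
    by_cases hfar : ∀ β, β ≠ α → M ≤ faceDist N v β
    · have hM₂M : M₂ α k ≤ M := le_trans
        (Finset.le_sup (f := fun q : (Fin d × Bool) × ℕ => M₂ q.1 q.2) (b := (α, k))
          (Finset.mem_product.2 ⟨Finset.mem_univ _, Finset.mem_range.2 hkK⟩)) (le_max_right _ _)
      have h1 := hM₂ α k N v hv rfl fun β hβ => hM₂M.trans (hfar β hβ)
      have h2 : |∑ β ∈ Finset.univ.erase α, ψ β (faceDist N v β)| ≤ δ := by
        have hle : ∀ β ∈ Finset.univ.erase α, |ψ β (faceDist N v β)| ≤ C * θ ^ M₁ := by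
          intro β hβ
          refine (hψ β _).trans (mul_le_mul_of_nonneg_left (hpow ?_) hC)
          have := hfar β (Finset.ne_of_mem_erase hβ)
          have := le_max_left M₁ ((Finset.univ ×ˢ Finset.range K).sup fun q => M₂ q.1 q.2)
          omega
        refine (Finset.abs_sum_le_sum_abs _ _).trans ((Finset.sum_le_sum hle).trans ?_)
        refine (Finset.sum_le_sum_of_subset_of_nonneg (Finset.subset_univ _)
          fun _ _ _ => by positivity).trans ?_
        rw [Finset.sum_const, nsmul_eq_mul, Finset.card_univ, ← mul_assoc]
        refine le_trans (mul_le_mul_of_nonneg_right ?_ (by positivity)) hM₁.le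
        rw [hC']
        linarith
      rw [← Finset.add_sum_erase _ _ (Finset.mem_univ α), ← sub_sub]
      have h3 := abs_sub (f N v - ψ α (faceDist N v α))
        (∑ β ∈ Finset.univ.erase α, ψ β (faceDist N v β))
      have h4 : ε * θ ^ K ≤ ε * θ ^ k := mul_le_mul_of_nonneg_left (hpow hkK.le) hε.le
      have h5 := mul_le_mul_of_nonneg_left hθsum hε.le
      have h6 := mul_nonneg hC0 (Finset.sum_nonneg fun α (_ : α ∈ Finset.univ) => hcorner' α)
      linarith
    -- A second face is closer than `M`, so `v` is in a corner and the crude bound suffices.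
    · push Not at hfar
      obtain ⟨β, hβ, hβM⟩ := hfar
      have hmem : v ∈ corner N M α β :=
        Finset.mem_filter.2 ⟨hv, (hα β).trans_lt hβM, hβM⟩
      have h1 : (1 : ℝ) ≤ ∑ β ∈ Finset.univ.erase α, if v ∈ corner N M α β then 1 else 0 := by
        have := Finset.single_le_sum (f := fun β => if v ∈ corner N M α β then (1 : ℝ) else 0)
          (fun β _ => hcorner α β) (Finset.mem_erase.2 ⟨hβ, Finset.mem_univ β⟩)
        simpa only [hmem, if_true] using this
      have h2 := Finset.single_le_sum (f := fun α => ∑ β ∈ Finset.univ.erase α,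
        if v ∈ corner N M α β then (1 : ℝ) else 0) (fun α _ => hcorner' α) (Finset.mem_univ α)
      have h3 : C' * θ ^ (2 * k) ≤ C' * 1 :=
        mul_le_mul_of_nonneg_left (pow_le_one₀ hθ0.le hθ1.le) hC0
      have h4 := mul_le_mul_of_nonneg_left (h1.trans h2) hC0
      have h5 : 0 ≤ ε * ∑ α, θ ^ faceDist N v α := by positivity
      linarith

theorem tendsto_two_mul_floor_add_one_div {a : ℝ} (ha : 0 < a) :
    Tendsto (fun n : ℕ => ((2 * ⌊a * n⌋₊ + 1 : ℕ) : ℝ) / n) atTop (𝓝 (2 * a)) := by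
  have h1 := ((tendsto_nat_floor_mul_div_atTop ha.le).comp
    (tendsto_natCast_atTop_atTop (R := ℝ))).const_mul 2
  have h2 := h1.add (tendsto_one_div_atTop_nhds_zero_nat (𝕜 := ℝ))
  rw [add_zero] at h2
  refine h2.congr fun n => ?_
  simp only [Function.comp_apply]
  push_cast
  ring

theorem tendsto_floor_mul_atTop {a : ℝ} (ha : 0 < a) :
    Tendsto (fun n : ℕ => ⌊a * n⌋₊) atTop atTop :=
  tendsto_nat_floor_atTop.comp (tendsto_natCast_atTop_atTop.const_mul_atTop ha)

theorem tendsto_faceCard_div {a : Fin d → ℝ} (ha : ∀ j, 0 < a j) (j : Fin d) :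
    Tendsto (fun n : ℕ => (faceCard (fun i => ⌊a i * n⌋₊) j : ℝ) / (n : ℝ) ^ (d - 1)) atTop
      (𝓝 (faceArea a j)) := by
  have h1 := tendsto_finsetProd (Finset.univ.erase j) fun i _ =>
    tendsto_two_mul_floor_add_one_div (ha i)
  refine h1.congr fun n => ?_
  rw [Finset.prod_div_distrib, Finset.prod_const, Finset.card_erase_of_mem (Finset.mem_univ j),
    Finset.card_univ, Fintype.card_fin, faceCard, Nat.cast_prod]

theorem tendsto_card_corner_div {a : Fin d → ℝ} (ha : ∀ j, 0 < a j) (M : ℕ) {α β : Fin d × Bool}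
    (hαβ : α ≠ β) :
    Tendsto (fun n : ℕ => ((corner (fun i => ⌊a i * n⌋₊) M α β).card : ℝ) / (n : ℝ) ^ (d - 1))
      atTop (𝓝 0) := by
  have hinv : Tendsto (fun n : ℕ => ((2 * ⌊a β.1 * n⌋₊ + 1 : ℕ) : ℝ)⁻¹) atTop (𝓝 0) := by
    refine tendsto_inv_atTop_zero.comp (tendsto_natCast_atTop_atTop.comp ?_)
    exact tendsto_atTop_mono (fun n => by omega) (tendsto_floor_mul_atTop (ha β.1))
  have hup := ((tendsto_faceCard_div ha α.1).const_mul ((M : ℝ) ^ 2)).mul hinv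
  rw [mul_zero] at hup
  refine squeeze_zero' (Eventually.of_forall fun n => by positivity) ?_ hup
  have hev : ∀ᶠ n : ℕ in atTop, ∀ j, M ≤ ⌊a j * n⌋₊ :=
    eventually_all.2 fun j => (tendsto_floor_mul_atTop (ha j)).eventually_ge_atTop M
  filter_upwards [hev] with n hn
  have := card_corner_mul_le hn hαβ
  rw [← div_eq_mul_inv, le_div_iff₀ (by positivity), div_mul_eq_mul_div, ← mul_div_assoc]
  exact div_le_div_of_nonneg_right (by exact_mod_cast this) (by positivity)

theorem tendsto_sum_symBox_div (hd : 1 ≤ d) {f : (Fin d → ℕ) → Site d → ℝ}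
    {ψ : Fin d × Bool → ℕ → ℝ} {C θ : ℝ} (hC : 0 ≤ C) (hθ0 : 0 < θ) (hθ1 : θ < 1)
    (hf : ∀ N, ∀ v ∈ symBox N, ∀ m, (∀ α, m ≤ faceDist N v α) → |f N v| ≤ C * θ ^ (2 * m))
    (hψ : ∀ α k, |ψ α k| ≤ C * θ ^ (2 * k))
    (hfψ : ∀ α k, ∀ ε > 0, ∃ M, ∀ N, ∀ v ∈ symBox N, faceDist N v α = k →
      (∀ β, β ≠ α → M ≤ faceDist N v β) → |f N v - ψ α k| ≤ ε)
    (hsum : ∀ α, Summable (ψ α)) {a : Fin d → ℝ} (ha : ∀ j, 0 < a j) :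
    Tendsto (fun n : ℕ => (∑ v ∈ symBox fun i => ⌊a i * n⌋₊, f (fun i => ⌊a i * n⌋₊) v) /
      (n : ℝ) ^ (d - 1)) atTop (𝓝 (∑ α, faceArea a α.1 * ∑' k, ψ α k)) := by
  let N (n : ℕ) (i : Fin d) : ℕ := ⌊a i * n⌋₊
  have hmain : Tendsto (fun n : ℕ => (∑ v ∈ symBox (N n), ∑ α, ψ α (faceDist (N n) v α)) /
      (n : ℝ) ^ (d - 1)) atTop (𝓝 (∑ α, faceArea a α.1 * ∑' k, ψ α k)) := by
    have h1 : ∀ α, Tendsto (fun n : ℕ => (faceCard (N n) α.1 : ℝ) / (n : ℝ) ^ (d - 1) *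
        ∑ k ∈ Finset.range (2 * N n α.1 + 1), ψ α k) atTop
        (𝓝 (faceArea a α.1 * ∑' k, ψ α k)) := by
      intro α
      refine (tendsto_faceCard_div ha α.1).mul ((hsum α).hasSum.tendsto_sum_nat.comp ?_)
      exact tendsto_atTop_mono (fun n => by simp only [N]; omega) (tendsto_floor_mul_atTop (ha α.1))
    refine (tendsto_finsetSum Finset.univ fun α _ => h1 α).congr fun n => ?_
    rw [Finset.sum_comm, Finset.sum_div]
    refine Finset.sum_congr rfl fun α _ => ?_
    rw [sum_symBox_faceDist]
    ring
  have herr : Tendsto (fun n : ℕ => (∑ v ∈ symBox (N n), (f (N n) v -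
      ∑ α, ψ α (faceDist (N n) v α))) / (n : ℝ) ^ (d - 1)) atTop (𝓝 0) := by
    -- This bounds the limit of the sum of all `θ ^ faceDist`, divided by `n ^ (d - 1)`, so the
    -- errors away from the corners stay below `ε` when `ε / (G + 1)` is used at each site.
    set G : ℝ := ∑ α : Fin d × Bool, faceArea a α.1 * (1 - θ)⁻¹ with hG
    have hθ1' : 0 < 1 - θ := sub_pos.2 hθ1
    have hG0 : 0 ≤ G := Finset.sum_nonneg fun α _ => mul_nonneg
      (Finset.prod_nonneg fun i _ => by have := ha i; positivity) (inv_nonneg.2 hθ1'.le)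
    rw [Metric.tendsto_atTop']
    intro ε hε
    have hG1 : 0 < G + 1 := by linarith
    obtain ⟨M, C', hC', hbound⟩ := exists_abs_sub_sum_faces_le hd hC hθ0 hθ1 hf hψ hfψ
      (div_pos hε hG1)
    have hlim : Tendsto (fun n : ℕ => ε / (G + 1) *
        (∑ α : Fin d × Bool, (faceCard (N n) α.1 : ℝ) / (n : ℝ) ^ (d - 1) * (1 - θ)⁻¹) +
        C' * ∑ α : Fin d × Bool, ∑ β ∈ Finset.univ.erase α,
          ((corner (N n) M α β).card : ℝ) / (n : ℝ) ^ (d - 1)) atTop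
        (𝓝 (ε / (G + 1) * G + C' * ∑ α : Fin d × Bool, ∑ β ∈ Finset.univ.erase α, 0)) := by
      refine Tendsto.add (Tendsto.const_mul _ ?_) (Tendsto.const_mul _ ?_)
      · exact tendsto_finsetSum _ fun α _ => (tendsto_faceCard_div ha α.1).mul_const _
      · exact tendsto_finsetSum _ fun α _ => tendsto_finsetSum _ fun β hβ =>
          tendsto_card_corner_div ha M (Finset.ne_of_mem_erase hβ).symm
    have hlt : ε / (G + 1) * G +
        C' * ∑ α : Fin d × Bool, ∑ β ∈ Finset.univ.erase α, (0 : ℝ) < ε := by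
      simp only [Finset.sum_const_zero, mul_zero, add_zero]
      rw [div_mul_eq_mul_div, div_lt_iff₀ hG1]
      linarith
    obtain ⟨n₀, hn₀⟩ := eventually_atTop.1 (hlim.eventually (gt_mem_nhds hlt))
    refine ⟨n₀, fun n hn => lt_of_le_of_lt ?_ (hn₀ n hn.le)⟩
    rw [Real.dist_eq, sub_zero, abs_div,
      abs_of_nonneg (by positivity : (0 : ℝ) ≤ (n : ℝ) ^ (d - 1))]
    have h1 : |∑ v ∈ symBox (N n), (f (N n) v - ∑ α, ψ α (faceDist (N n) v α))| ≤
        ε / (G + 1) * (∑ α : Fin d × Bool, (faceCard (N n) α.1 : ℝ) * (1 - θ)⁻¹) +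
        C' * ∑ α : Fin d × Bool, ∑ β ∈ Finset.univ.erase α, ((corner (N n) M α β).card : ℝ) := by
      refine (Finset.abs_sum_le_sum_abs _ _).trans
        ((Finset.sum_le_sum fun v hv => hbound (N n) v hv).trans ?_)
      rw [Finset.sum_add_distrib, ← Finset.mul_sum, ← Finset.mul_sum]
      refine add_le_add (mul_le_mul_of_nonneg_left ?_ (by positivity))
        (mul_le_mul_of_nonneg_left ?_ hC')
      · rw [Finset.sum_comm]
        refine Finset.sum_le_sum fun α _ => ?_
        rw [sum_symBox_faceDist (N n) α fun k => θ ^ k]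
        refine mul_le_mul_of_nonneg_left ?_ (Nat.cast_nonneg _)
        rw [← tsum_geometric_of_lt_one hθ0.le hθ1]
        exact (summable_geometric_of_lt_one hθ0.le hθ1).sum_le_tsum _ fun _ _ => by positivity
      · rw [Finset.sum_comm]
        refine Finset.sum_le_sum fun α _ => ?_
        rw [Finset.sum_comm]
        refine Finset.sum_le_sum fun β _ => ?_
        rw [← Finset.sum_filter, Finset.sum_const, nsmul_eq_mul, mul_one]
        exact Nat.cast_le.2 (Finset.card_le_card fun v hv => (Finset.mem_filter.1 hv).2)
    refine (div_le_div_of_nonneg_right h1 (by positivity)).trans (le_of_eq ?_)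
    rw [add_div, mul_div_assoc, mul_div_assoc, Finset.sum_div, Finset.sum_div]
    congr 2
    · exact Finset.sum_congr rfl fun α _ => by ring
    · exact Finset.sum_congr rfl fun α _ => by rw [Finset.sum_div]
  have := herr.add hmain
  rw [zero_add] at this
  refine this.congr fun n => ?_
  rw [← add_div, ← Finset.sum_add_distrib]
  simp only [sub_add_cancel, N]

end

/-! ### The surface pressure -/

section

variable {d : ℕ}

/-- The half-space that looks like a box near a site at distance `k` from the face `α`. -/
def halfSpace (α : Fin d × Bool) (k : ℕ) : Set (Site d) :=
  if α.2 then halfPlus α.1 k else halfMinus α.1 k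

theorem mem_halfSpace {α : Fin d × Bool} {k : ℕ} {u : Site d} :
    u ∈ halfSpace α k ↔ if α.2 then u α.1 ≤ k else -(k : ℤ) ≤ u α.1 := by
  unfold halfSpace
  split_ifs <;> rfl

theorem natAbs_apply_le_l1 (u : Site d) (j : Fin d) : (u j).natAbs ≤ l1 u 0 := by
  unfold l1
  have := Finset.single_le_sum (f := fun i => (u i - (0 : Site d) i).natAbs)
    (fun _ _ => Nat.zero_le _) (Finset.mem_univ j)
  simpa using this

theorem mem_ball_zero {r : ℕ} {u : Site d} : u ∈ ball {0} r ↔ l1 u 0 ≤ r := by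
  simp [mem_ball]

theorem ball_subset_halfSpace (α : Fin d × Bool) (k : ℕ) :
    (ball {(0 : Site d)} k : Set (Site d)) ⊆ halfSpace α k := by
  intro u hu
  have h1 := mem_ball_zero.1 (Finset.mem_coe.1 hu)
  have h2 := natAbs_apply_le_l1 u α.1
  rw [mem_halfSpace]
  split_ifs <;> omega

/-- A box seen from one of its sites is the intersection of `2 d` half-spaces; when only one of them
is visible within a given radius, the box looks like that half-space. -/
theorem mem_shift_symBox {N : Fin d → ℕ} {v : Site d} (hv : v ∈ symBox N) {u : Site d} :
    u ∈ shift (symBox N) v ↔ ∀ α, u ∈ halfSpace α (faceDist N v α) := by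
  rw [mem_shift, mem_symBox]
  rw [mem_symBox] at hv
  simp only [mem_halfSpace, faceDist, Prod.forall, Bool.forall_bool, Bool.false_eq_true, if_false,
    if_true, Pi.add_apply]
  refine forall_congr' fun j => ?_
  have := hv j
  omega

theorem ball_subset_shift_symBox {N : Fin d → ℕ} {v : Site d} (hv : v ∈ symBox N) {m : ℕ}
    (hm : ∀ α, m ≤ faceDist N v α) : ball {0} m ⊆ shift (symBox N) v := by
  intro u hu
  rw [mem_shift_symBox hv]
  refine fun α => ball_subset_halfSpace α _ ?_
  exact Finset.mem_coe.2 (mem_ball_zero.2 ((mem_ball_zero.1 hu).trans (hm α)))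

variable {χ : Type*} {H : χ → χ → WithTop ℝ} {h : χ → ℝ} [Fintype χ]
  [MeasurableSpace χ] [MeasurableSingletonClass χ] {s : χ}

theorem summable_and_isSurfacePressure (hd : 1 ≤ d) (hsymm : ∀ s t, H s t = H t s)
    (hs : ∀ t, H t s ≠ ⊤) {x : ℝ} (hx : H s s = x) (hexp : ExpSSM d H h) {p : ℝ}
    (hp : IsCavityMarginal H h (Set.univ : Set (Site d)) s p) {q : Fin d × Bool → ℕ → ℝ}
    (hq : ∀ α k, IsCavityMarginal H h (halfSpace α k) s (q α k)) :
    (∀ α, Summable fun k => Real.log p - Real.log (q α k)) ∧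
    ∀ a : Fin d → ℝ, (∀ j, 0 < a j) →
      IsSurfacePressure H h (-Real.log p - d * x - h s) a
        (x + ∑ j, faceArea a j / area a * ∑ b, ∑' k, (Real.log p - Real.log (q (j, b) k))) := by
  obtain ⟨c, hc, hcD, hcΛ⟩ := exists_pos_le_cavity (d := d) (h := h) hsymm hs hx
  obtain ⟨κ, γ, hκ, hγ, hR⟩ := hexp {0} {u | LexLT 0 u}
  have hcp : c ≤ p := hcD _ (Set.mem_univ _) p hp
  have hzero : ∀ (α : Fin d × Bool) k, (0 : Site d) ∈ halfSpace α k := fun α k =>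
    ball_subset_halfSpace α k (Finset.mem_coe.2 (mem_ball_zero.2 (by simp [l1])))
  have hcq : ∀ α k, c ≤ q α k := fun α k => hcD _ (hzero α k) _ (hq α k)
  -- Half of the mixing rate, so that the decay is `θ ^ (2 * m)` and can be split in two.
  set θ : ℝ := Real.exp (-γ / 2) with hθ
  have hθ0 : 0 < θ := Real.exp_pos _
  have hθ1 : θ < 1 := by
    rw [hθ, ← Real.exp_zero, Real.exp_lt_exp]
    linarith
  have hθpow : ∀ m : ℕ, Real.exp (-γ * m) = θ ^ (2 * m) := fun m => by
    rw [hθ, ← Real.exp_nat_mul]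
    congr 1
    push_cast
    ring
  -- The summand `1` covers `m = 0`, where mixing says nothing and only the trivial bound on a
  -- difference of probabilities is left.
  set C : ℝ := (κ + 1) / c with hC
  have hC0 : 0 ≤ C := by positivity
  have hlog : ∀ (m : ℕ) (y : ℝ), c ≤ y → y ≤ 1 → (1 ≤ m → |p - y| ≤ κ * Real.exp (-γ * m)) →
      |Real.log p - Real.log y| ≤ C * θ ^ (2 * m) := by
    intro m y hy hy1 hm
    refine (abs_log_sub_log_le hc hcp hy).trans ?_
    rw [hC, div_mul_eq_mul_div]
    refine div_le_div_of_nonneg_right ?_ hc.le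
    rcases Nat.eq_zero_or_pos m with rfl | hpos
    · rw [mul_zero, pow_zero, abs_le]
      constructor <;> linarith [hp.le_one]
    · refine (hm hpos).trans ?_
      rw [hθpow]
      exact mul_le_mul_of_nonneg_right (by linarith) (by positivity)
  let f (N : Fin d → ℕ) (v : Site d) : ℝ :=
    Real.log p - Real.log (cavityProb H h s (shift (symBox N) v))
  let ψ (α : Fin d × Bool) (k : ℕ) : ℝ := Real.log p - Real.log (q α k)
  have hf : ∀ N, ∀ v ∈ symBox N, ∀ m, (∀ α, m ≤ faceDist N v α) → |f N v| ≤ C * θ ^ (2 * m) := by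
    intro N v hv m hm
    refine hlog m _ (hcΛ _ (zero_mem_shift.2 hv)) (cavityProb_le_one hx _) fun hm1 => ?_
    rw [abs_sub_comm]
    exact hp.abs_cavityProb_sub_le hx hR hm1 (Set.subset_univ _) (ball_subset_shift_symBox hv hm)
  have hψ : ∀ α k, |ψ α k| ≤ C * θ ^ (2 * k) := fun α k =>
    hlog k _ (hcq α k) (hq α k).le_one fun hk =>
      hp.abs_sub_le (hq α k) hR hk (Set.subset_univ _) (ball_subset_halfSpace α k)
  have hfψ : ∀ α k, ∀ ε > 0, ∃ M, ∀ N, ∀ v ∈ symBox N, faceDist N v α = k →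
      (∀ β, β ≠ α → M ≤ faceDist N v β) → |f N v - ψ α k| ≤ ε := by
    intro α k ε hε
    obtain ⟨M, hM⟩ := exists_abs_cavityProb_sub_lt (hzero α k) (hq α k) hx (mul_pos hε hc)
    refine ⟨M, fun N v hv hk hfar => ?_⟩
    have h1 : |cavityProb H h s (shift (symBox N) v) - q α k| < ε * c := by
      refine hM _ fun u hu => ?_
      rw [mem_shift_symBox hv]
      refine ⟨fun hall => hk ▸ hall α, fun hα β => ?_⟩
      by_cases hβ : β = α
      · rw [hβ, hk]
        exact hα
      · exact ball_subset_halfSpace β _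
          (Finset.mem_coe.2 (mem_ball_zero.2 (hu.trans (hfar β hβ))))
    have h2 := abs_log_sub_log_le hc (hcq α k) (hcΛ _ (zero_mem_shift.2 hv))
    rw [abs_sub_comm] at h1
    have h3 : |q α k - cavityProb H h s (shift (symBox N) v)| / c ≤ ε := by
      rw [div_le_iff₀ hc]
      exact h1.le
    have h4 : f N v - ψ α k =
        Real.log (q α k) - Real.log (cavityProb H h s (shift (symBox N) v)) := by
      simp only [f, ψ]
      ring
    rw [h4]
    exact h2.trans h3
  have hsum : ∀ α, Summable (ψ α) := fun α => by
    refine Summable.of_norm_bounded (g := fun k => C * (θ ^ 2) ^ k) ?_ fun k => ?_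
    · exact (summable_geometric_of_lt_one (by positivity)
        (pow_lt_one₀ hθ0.le hθ1 two_ne_zero)).mul_left C
    · rw [Real.norm_eq_abs, ← pow_mul]
      exact hψ α k
  refine ⟨hsum, fun a ha => ?_⟩
  have hlim := tendsto_sum_symBox_div hd hC0 hθ0 hθ1 hf hψ hfψ hsum ha
  have hface : ∀ j, 0 < faceArea a j := fun j =>
    Finset.prod_pos fun i _ => by have := ha i; positivity
  have harea : 0 < area a := Finset.sum_pos (fun j _ => hface j) ⟨⟨0, hd⟩, Finset.mem_univ _⟩
  -- Along each axis the box lacks one edge per site of the upper face, compared with `d` edges per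
  -- site. After division by `area a` these give the summand `x`.
  have hfaces : Tendsto (fun n : ℕ => (∑ j, (faceCard (fun i => ⌊a i * n⌋₊) j : ℝ) /
      (n : ℝ) ^ (d - 1)) * x) atTop (𝓝 (area a * x)) :=
    (tendsto_finsetSum _ fun j _ => tendsto_faceCard_div ha j).mul_const x
  have hall := (hfaces.add hlim).div_const (area a)
  have hval : (area a * x + ∑ α : Fin d × Bool, faceArea a α.1 * ∑' k, ψ α k) / area a =
      x + ∑ j, faceArea a j / area a * ∑ b, ∑' k, (Real.log p - Real.log (q (j, b) k)) := by
    rw [add_div, mul_div_cancel_left₀ _ harea.ne', Fintype.sum_prod_type, Finset.sum_div]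
    congr 1
    refine Finset.sum_congr rfl fun j _ => ?_
    simp only [ψ]
    rw [← Finset.mul_sum, mul_div_right_comm]
  rw [hval] at hall
  refine hall.congr fun n => ?_
  set N : Fin d → ℕ := fun i => ⌊a i * n⌋₊ with hN
  have hedge := edgeCount_add_sum_card (symBox N)
  rw [Finset.sum_congr rfl fun j _ => by rw [card_filter_add_single_notMem]] at hedge
  rw [box_eq_symBox ha, log_partitionFn hx, div_mul_eq_div_div_swap]
  congr 1
  rw [← Finset.sum_div, div_mul_eq_mul_div, ← add_div]
  congr 1
  simp only [f]
  rw [Finset.sum_sub_distrib, Finset.sum_const, nsmul_eq_mul,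
    show (edgeCount (symBox N) : ℝ) = d * (symBox N).card - ∑ j, (faceCard N j : ℝ) by linarith]
  ring

end

end SpinModel

end

/-! ### Assembly -/

open SpinModel in
theorem theorem1 {d : ℕ} (hd : 1 ≤ d) {χ : Type*} [Fintype χ] [MeasurableSpace χ]
    [MeasurableSingletonClass χ] (H : χ → χ → WithTop ℝ) (hsymm : ∀ s t, H s t = H t s)
    (h : χ → ℝ) (s : χ) (hs : ∀ t, H t s ≠ ⊤) (hSSM : SSM d H h) :
    ∃ p : ℝ, 0 < p ∧ IsCavityMarginal H h (Set.univ : Set (Site d)) s p ∧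
      IsFreeEnergy d H h (-Real.log p - d * (H s s).untop (hs s) - h s) ∧
      (ExpSSM d H h →
        ∀ pPlus pMinus : Fin d → ℕ → ℝ,
          (∀ j k, IsCavityMarginal H h (halfPlus j k) s (pPlus j k)) →
          (∀ j k, IsCavityMarginal H h (halfMinus j k) s (pMinus j k)) →
          (∀ j k, 0 < pPlus j k ∧ 0 < pMinus j k) ∧
          (∀ j, Summable fun k : ℕ =>
            2 * Real.log p - Real.log (pPlus j k) - Real.log (pMinus j k)) ∧
          ∀ a : Fin d → ℝ, (∀ j, 0 < a j) →
            IsSurfacePressure H h (-Real.log p - d * (H s s).untop (hs s) - h s) a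
              ((H s s).untop (hs s) + ∑ j, faceArea a j / area a *
                ∑' k : ℕ, (2 * Real.log p - Real.log (pPlus j k) - Real.log (pMinus j k)))) := by
  have hx : H s s = ((H s s).untop (hs s) : ℝ) := (WithTop.coe_untop _ _).symm
  set x : ℝ := (H s s).untop (hs s)
  obtain ⟨p, hp⟩ := exists_isCavityMarginal_univ hx hSSM
  obtain ⟨c, hc, hcD, -⟩ := exists_pos_le_cavity (d := d) (h := h) hsymm hs hx
  refine ⟨p, hc.trans_le (hcD _ (Set.mem_univ _) p hp), hp,
    isFreeEnergy_of_isCavityMarginal hsymm hs hx hp, fun hexp pPlus pMinus hplus hminus => ?_⟩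
  -- Both half-spaces of an axis are handled as faces, each with its own `Real.log p`. The two
  -- series converge separately, so they may be added term by term.
  let q (α : Fin d × Bool) (k : ℕ) : ℝ := if α.2 then pPlus α.1 k else pMinus α.1 k
  have hq : ∀ α k, IsCavityMarginal H h (halfSpace α k) s (q α k) := by
    rintro ⟨j, _ | _⟩ k
    exacts [hminus j k, hplus j k]
  obtain ⟨hsum, hlim⟩ := summable_and_isSurfacePressure hd hsymm hs hx hexp hp hq
  have hterm : ∀ j k, 2 * Real.log p - Real.log (pPlus j k) - Real.log (pMinus j k) =
      (Real.log p - Real.log (q (j, true) k)) + (Real.log p - Real.log (q (j, false) k)) := by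
    intro j k
    simp only [q, if_true, Bool.false_eq_true, if_false]
    ring
  refine ⟨fun j k => ⟨hc.trans_le (hcD _ ?_ _ (hplus j k)), hc.trans_le (hcD _ ?_ _ (hminus j k))⟩,
    fun j => ?_, fun a ha => ?_⟩
  · exact Int.natCast_nonneg k
  · exact neg_nonpos.2 (Int.natCast_nonneg k)
  · simp only [hterm]
    exact (hsum (j, true)).add (hsum (j, false))
  · have hj : ∀ j, ∑' k : ℕ, (2 * Real.log p - Real.log (pPlus j k) - Real.log (pMinus j k)) =
        ∑ b, ∑' k, (Real.log p - Real.log (q (j, b) k)) := by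
      intro j
      simp only [hterm]
      rw [(hsum (j, true)).tsum_add (hsum (j, false)), Fintype.sum_bool]
    simp only [hj]
    exact hlim a ha
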